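/- Let $G$ be a $d$-regular simple graph on the vertex set $\{1,\dots,N\}$, whose vertices are servers, and let $\lambda>0$, $\mu_1>\mu_2>0$. \emph{Graph model.} For every server $v$, jobs arrive as independent Poisson processes of rate $\lambda$; the primary selection of a job arriving at $v$ consists of $v$ and its neighbours in $G$. An arriving job with primary selection $S$ is sent (1) to a completely idle server of $S$, as a type-I job, if there is one; (2) otherwise to a completely idle server outside $S$, as a type-II job, if there is one; (3) otherwise, as a type-I job, to a server of $S$ with the smallest number of type-I jobs and, among those, the smallest number of type-II jobs; remaining ties are broken by an arbitrary (possibly random, depending on the current state and $v$) rule. Type-I and type-II jobs have independent exponential service times with rates $\mu_1$ and $\mu_2$, respectively, and at every server type-I jobs have preemptive priority. \emph{Reference system.} In the $N$-server JSQ($k$) system, $k\ge 1$, jobs arrive at total rate $\lambda N$; each job samples a uniformly random set of $k$ distinct servers and joins a shortest queue among them (ties being broken arbitrarily); every server works at rate $\mu_1$. Let $\overline{Q}_i^{\mathrm{aff}}(t)$ be the number of servers with at least $i$ type-I jobs at time $t$ in the graph model, let $\overline{Q}_i^{\mathrm{JSQ}(k)}(t)$ be the number of servers with at least $i$ jobs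 at time $t$ in the reference system, and set $\overline{Q}_{m+}(t)=\sum_{i\ge m}\overline{Q}_i(t)$ in both cases. Suppose that $$\sum_{i=1}^{N-d-1}\binom{N-i}{k-1}<\frac{d+1}{N}\binom{N}{k},$$ and that the initial configurations can be realized jointly so that $\overline{Q}_{m+}^{\mathrm{aff}}(0)\le\overline{Q}_{m+}^{\mathrm{JSQ}(k)}(0)$ for all $m\ge1$. Then $$\{(\overline{Q}_{m+}^{\mathrm{aff}}(t))_{m\ge1}\}_{t\ge0}\le_{\mathrm{st}}\{(\overline{Q}_{m+}^{\mathrm{JSQ}(k)}(t))_{m\ge1}\}_{t\ge0},$$ that is: the two systems, with the given initial distributions, can be constructed on a common probability space such that almost surely $\overline{Q}_{m+}^{\mathrm{aff}}(t)\le\overline{Q}_{m+}^{\mathrm{JSQ}(k)}(t)$ for all $t\ge0$ and $m\ge1$ simultaneously; and for any two versions of the processes, on arbitrary probability spaces, every measurable increasing set of paths has at most as large a probability under the law of the first tail-sum process as under the law of the second. -/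

import Mathlib

open MeasureTheory Filter Topology
open scoped NNReal

noncomputable section

namespace AffinityScheduling

/-! ### Continuous-time Markov chains with bounded rates -/

/-- The transition function `p_t(x, y) = (exp (t L) 1_y) (x)` of the continuous-time Markov chain
with generator `L` (acting on all real functions of the state; in the two models below `L f x` is
a finite sum and the total jump rate out of a state is bounded, so that the exponential series
converges absolutely). -/
def transProb {S : Type*} [DecidableEq S] (L : (S → ℝ) → (S → ℝ)) (t : ℝ) (x y : S) : ℝ :=
  ∑' n : ℕ, t ^ n / (n.factorial : ℝ) * (L^[n] (fun z => if z = y then 1 else 0)) x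

/-- `X` is a continuous-time, time-homogeneous Markov chain with generator `L` and initial
distribution `init`, with piecewise constant, right-continuous paths that have finitely many jumps
in bounded time intervals. -/
structure IsMarkovChain {S Ω : Type*} [DecidableEq S] [MeasurableSpace S] [MeasurableSpace Ω]
    (L : (S → ℝ) → (S → ℝ)) (init : PMF S) (P : Measure Ω) (X : ℝ≥0 → Ω → S) : Prop where
  /-- each `X t` is a random variable -/
  measurable : ∀ t, Measurable (X t)
  /-- almost surely, the path is right-continuous with left limits (in the discrete topology) -/
  cadlag : ∀ᵐ ω ∂P, ∀ t, (∀ᶠ s in 𝓝[>] t, X s ω = X t ω) ∧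
    ∃ x, ∀ᶠ s in 𝓝[<] t, X s ω = x
  /-- the initial distribution -/
  initial : ∀ x, P {ω | X 0 ω = x} = init x
  /-- the Markov property, with transition function `transProb L` -/
  markov : ∀ (n : ℕ) (t : ℕ → ℝ≥0), Monotone t → ∀ x : ℕ → S,
    P.real {ω | ∀ i ≤ n + 1, X (t i) ω = x i} =
      P.real {ω | ∀ i ≤ n, X (t i) ω = x i} *
        transProb L ((t (n + 1) : ℝ) - (t n : ℝ)) (x n) (x (n + 1))

/-! ### The affinity-scheduling graph model -/

/-- Configuration of the `N` servers: `(x n).1` type-I jobs and `(x n).2` type-II jobs at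
server `n`. -/
abbrev AffState (N : ℕ) : Type := Fin N → ℕ × ℕ

/-- The primary selection of a job that arrives at `v`: the server `v` and its neighbours. -/
def primary {N : ℕ} (G : SimpleGraph (Fin N)) [DecidableRel G.Adj] (v : Fin N) :
    Finset (Fin N) :=
  insert v (G.neighborFinset v)

/-- Server `u` is completely idle. -/
def Idle {N : ℕ} (x : AffState N) (u : Fin N) : Prop :=
  (x u).1 = 0 ∧ (x u).2 = 0

/-- In configuration `x`, the allocation strategy may send a job with primary selection `A` to
server `u`. The three alternatives are the three steps of the strategy:
an idle primary server; if there is none, an idle secondary server; if no server is idle, a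
primary server with the fewest type-I jobs and, among those, the fewest type-II jobs. -/
def Admissible {N : ℕ} (x : AffState N) (A : Finset (Fin N)) (u : Fin N) : Prop :=
  (u ∈ A ∧ Idle x u) ∨
  ((∀ w ∈ A, ¬ Idle x w) ∧ u ∉ A ∧ Idle x u) ∨
  ((∀ w, ¬ Idle x w) ∧ u ∈ A ∧
    ∀ w ∈ A, (x u).1 < (x w).1 ∨ ((x u).1 = (x w).1 ∧ (x u).2 ≤ (x w).2))

/-- `alloc x v` is the (possibly random) server that receives a job arriving at `v` in
configuration `x`. It obeys the allocation strategy; the choice among several admissible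
servers is arbitrary. -/
def IsAffinityRule {N : ℕ} (G : SimpleGraph (Fin N)) [DecidableRel G.Adj]
    (alloc : AffState N → Fin N → PMF (Fin N)) : Prop :=
  ∀ x v, ∀ u ∈ (alloc x v).support, Admissible x (primary G v) u

/-- Add a job with primary selection `A` at server `u`: it is of type I if `u ∈ A` and of
type II otherwise. -/
def addJob {N : ℕ} (x : AffState N) (A : Finset (Fin N)) (u : Fin N) : AffState N :=
  Function.update x u (if u ∈ A then ((x u).1 + 1, (x u).2) else ((x u).1, (x u).2 + 1))

/-- Service completion at server `u` (type-I jobs have preemptive priority). -/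
def completeJob {N : ℕ} (x : AffState N) (u : Fin N) : AffState N :=
  Function.update x u (if 0 < (x u).1 then ((x u).1 - 1, (x u).2) else ((x u).1, (x u).2 - 1))

/-- The rate at which server `u` completes jobs. -/
def serviceRate {N : ℕ} (μ₁ μ₂ : ℝ) (x : AffState N) (u : Fin N) : ℝ :=
  if 0 < (x u).1 then μ₁ else if 0 < (x u).2 then μ₂ else 0

/-- Generator of the graph model: for every server `v`, jobs with primary selection
`primary G v` arrive at rate `lam`. -/
def affGen {N : ℕ} (G : SimpleGraph (Fin N)) [DecidableRel G.Adj] (lam μ₁ μ₂ : ℝ)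
    (alloc : AffState N → Fin N → PMF (Fin N)) (f : AffState N → ℝ) (x : AffState N) : ℝ :=
  (∑ v : Fin N, lam * ∑ u : Fin N, (alloc x v u).toReal * (f (addJob x (primary G v) u) - f x)) +
    ∑ u : Fin N, serviceRate μ₁ μ₂ x u * (f (completeJob x u) - f x)

/-! ### The reference system: JSQ(`k`) -/

/-- Queue lengths of the `N` servers of the reference system. -/
abbrev RefState (N : ℕ) : Type := Fin N → ℕ

/-- `alloc y A` is the (possibly random) server that receives a job for which the set `A` of `k`
servers has been sampled: a server of `A` with the shortest queue, ties being broken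
arbitrarily. -/
def IsJSQRule {N : ℕ} (k : ℕ) (alloc : RefState N → Finset (Fin N) → PMF (Fin N)) : Prop :=
  ∀ y A, A.card = k → ∀ u ∈ (alloc y A).support, u ∈ A ∧ ∀ w ∈ A, y u ≤ y w

/-- Generator of the `N`-server JSQ(`k`) system: jobs arrive at total rate `lam * N`, each samples
a uniformly random set of `k` distinct servers, and every busy server works at rate `μ₁`. -/
def jsqGen {N : ℕ} (k : ℕ) (lam μ₁ : ℝ)
    (alloc : RefState N → Finset (Fin N) → PMF (Fin N)) (g : RefState N → ℝ)
    (y : RefState N) : ℝ :=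
  (∑ A ∈ (Finset.univ : Finset (Fin N)).powersetCard k, lam * N / (N.choose k : ℝ) *
      ∑ u : Fin N, (alloc y A u).toReal * (g (Function.update y u (y u + 1)) - g y)) +
    ∑ u : Fin N, (if 0 < y u then μ₁ else 0) * (g (Function.update y u (y u - 1)) - g y)

/-! ### Occupancy and stochastic order -/

/-- The number of servers with at least `i` jobs, for the vector `q` of queue lengths. -/
def occupancy {N : ℕ} (q : Fin N → ℕ) (i : ℕ) : ℕ :=
  (Finset.univ.filter fun n => i ≤ q n).card

/-- The tail sums `∑_{i ≥ m} occupancy q i`, for `m ≥ 1` (only finitely many terms are nonzero). -/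
def tailSums {N : ℕ} (q : Fin N → ℕ) (m : ℕ+) : ℕ :=
  ∑' j : ℕ, occupancy q ((m : ℕ) + j)

/-- The vector of the numbers of type-I jobs. -/
def typeI {N : ℕ} (x : AffState N) : Fin N → ℕ := fun n => (x n).1

/-- The initial configurations of both systems satisfy the tail-sum inequalities: they can be
realized jointly in such a way that all the inequalities hold. -/
def InitiallyOrdered {N : ℕ} (a : PMF (AffState N)) (b : PMF (RefState N)) : Prop :=
  ∃ c : PMF (AffState N × RefState N), c.map Prod.fst = a ∧ c.map Prod.snd = b ∧
    ∀ p ∈ c.support, ∀ m, tailSums (typeI p.1) m ≤ tailSums p.2 m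

/-- Usual stochastic order of processes, possibly on different probability spaces:
`P (X ∈ U) ≤ Q (Y ∈ U)` for all measurable increasing sets `U` of paths. -/
def StochLE {E Ω Ω' : Type*} [Preorder E] [MeasurableSpace E] [MeasurableSpace Ω]
    [MeasurableSpace Ω'] (P : Measure Ω) (X : ℝ≥0 → Ω → E) (Q : Measure Ω')
    (Y : ℝ≥0 → Ω' → E) : Prop :=
  ∀ U : Set (ℝ≥0 → E), MeasurableSet U → IsUpperSet U →
    P {ω | (fun t => X t ω) ∈ U} ≤ Q {ω | (fun t => Y t ω) ∈ U}

end AffinityScheduling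

end

/-! The two systems are coupled step by step. Both chains are uniformized at the common rate `N *
(lam + μ₁)`: at the points of a Poisson process either an arrival or a potential departure takes
place. It suffices to couple the steps of the two jump chains so that the order of tail sums
(`TailLE`) survives each step (`exists_step_coupling`). Shared exponential holding times then give
ordered processes in continuous time. Each coordinate is itself a Markov chain, because the coupled
step projects to its own uniformized kernel (`isMarkovChain_jumpProcess`).

A step changes a tail sum by at most one, so the order can break only at a level where the two tail
sums agree. There the inequality at an adjacent level becomes a comparison of occupancies
(`excess_eq_add`), which matching by rank can use (`exists_perm_rank_matching`). For departures,
servers of equal rank are matched; a type-II service uses only a part `μ₂` of the rate `μ₁` and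
leaves the type-I tail sums alone.

For arrivals, an idle server makes the step harmless: at most level 1 grows, and it grows in the
reference system too. Otherwise level `m + 1` grows in the graph model only if the whole primary
selection lies in the set `H` of servers with at least `m` type-I jobs. If `H` misses a server, it
contains at most `N - d - 1` primary selections, and none if it has fewer than `d + 1` elements. By
the hockey-stick identity the hypothesis says `1 - C(d+1,k)/C(N,k) < (d+1)/N`. Hence a random
`k`-sample lies in a set at least as large as `H` with at least the probability that a random
primary selection lies in `H` (`card_primary_subset_mul_le`).

For arbitrary versions, generator and initial distribution determine the law on path space
(`IsMarkovChain.map_path_eq`), so the stochastic order is read off from the coupling. -/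

noncomputable section

namespace AffinityScheduling

open scoped ENNReal

/-! ### Exponential holding times -/

/-- The exponential distribution with rate `r`, as a law on `ℝ≥0`. -/
def expHolding (r : ℝ) : Measure ℝ≥0 := (ProbabilityTheory.expMeasure r).map Real.toNNReal

lemma isProbabilityMeasure_expHolding {r : ℝ} (hr : 0 < r) :
    IsProbabilityMeasure (expHolding r) :=
  have := ProbabilityTheory.isProbabilityMeasure_expMeasure hr
  Measure.isProbabilityMeasure_map measurable_real_toNNReal.aemeasurable

lemma lintegral_expHolding (r : ℝ) {f : ℝ≥0 → ℝ≥0∞} (hf : Measurable f) :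
    ∫⁻ s, f s ∂expHolding r =
      ∫⁻ x in Set.Ioi (0 : ℝ), ENNReal.ofReal (r * Real.exp (-(r * x))) * f x.toNNReal := by
  rw [expHolding, lintegral_map hf measurable_real_toNNReal]
  have h : ProbabilityTheory.expMeasure r =
      volume.withDensity (ProbabilityTheory.exponentialPDF r) := rfl
  have hm : Measurable (ProbabilityTheory.exponentialPDF r) :=
    (ProbabilityTheory.measurable_exponentialPDFReal r).ennreal_ofReal
  rw [h, lintegral_withDensity_eq_lintegral_mul _ hm
      (g := fun x => f x.toNNReal) (hf.comp measurable_real_toNNReal),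
    setLIntegral_congr Ioi_ae_eq_Ici, ← lintegral_indicator measurableSet_Ici]
  refine lintegral_congr fun x => ?_
  by_cases hx : 0 ≤ x
  · simp [Set.indicator, hx, ProbabilityTheory.exponentialPDF_of_nonneg hx]
  · simp [Set.indicator, hx, ProbabilityTheory.exponentialPDF_of_neg (not_le.mp hx)]

/-- Memorylessness: translating by `t` multiplies the exponential density by `e^{-rt}`. -/
lemma lintegral_expHolding_residual (r : ℝ) (t : ℝ≥0) {g : ℝ≥0 → ℝ≥0∞} (hg : Measurable g) :
    ∫⁻ s, (if t < s then g (s - t) else 0) ∂expHolding r =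
      ENNReal.ofReal (Real.exp (-(r * t))) * ∫⁻ s, g s ∂expHolding r := by
  have hm : Measurable fun s : ℝ≥0 => if t < s then g (s - t) else 0 :=
    Measurable.ite measurableSet_Ioi (hg.comp (measurable_id.sub_const t)) measurable_const
  rw [lintegral_expHolding r hg, lintegral_expHolding r hm,
    ← lintegral_const_mul _ (by fun_prop), ← lintegral_indicator measurableSet_Ioi,
    ← lintegral_indicator measurableSet_Ioi, eq_comm, ← lintegral_sub_right_eq_self _ (t : ℝ),
    eq_comm]
  refine lintegral_congr fun x => ?_
  have ht : (0 : ℝ) ≤ t := t.2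
  by_cases hx : (t : ℝ) < x
  · have h0 : 0 < x := ht.trans_lt hx
    have h1 : t < x.toNNReal := by rwa [Real.lt_toNNReal_iff_coe_lt]
    have h2 : x.toNNReal - t = (x - t).toNNReal := by
      ext
      rw [NNReal.coe_sub h1.le, Real.coe_toNNReal _ h0.le, Real.coe_toNNReal _ (by linarith)]
    have h3 : Real.exp (-(r * x)) = Real.exp (-(r * t)) * Real.exp (-(r * (x - t))) := by
      rw [← Real.exp_add]; ring_nf
    simp only [Set.indicator, Set.mem_Ioi, h0, if_true, h1, sub_pos, hx, h2]
    rw [← mul_assoc, ← ENNReal.ofReal_mul (Real.exp_nonneg _), h3]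
    congr 2
    ring
  · have h1 : ¬ t < x.toNNReal := by rwa [Real.lt_toNNReal_iff_coe_lt]
    simp [Set.indicator, h1, hx]

/-- The Poisson weights `e^{-rt} (rt)^n / n!`. -/
def poissonWeight (r t : ℝ) (n : ℕ) : ℝ := Real.exp (-(r * t)) * (r * t) ^ n / n.factorial

lemma poissonWeight_nonneg {r t : ℝ} (hr : 0 ≤ r) (ht : 0 ≤ t) (n : ℕ) :
    0 ≤ poissonWeight r t n := by
  unfold poissonWeight; positivity

lemma hasSum_poissonWeight (r t : ℝ) : HasSum (poissonWeight r t) 1 := by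
  have h := (NormedSpace.expSeries_div_hasSum_exp (r * t)).mul_left (Real.exp (-(r * t)))
  rw [← Real.exp_eq_exp_ℝ, ← Real.exp_add, neg_add_cancel, Real.exp_zero] at h
  refine h.congr_fun ?_
  intro n
  simp [poissonWeight, mul_div_assoc]

/-- Conditioning on the first point of a Poisson process. The exponentials combine to the constant
`e^{-rt}`, which leaves the integral of a power of `t - s`. -/
lemma lintegral_expHolding_poissonWeight {r : ℝ} (hr : 0 < r) (t : ℝ≥0) (n : ℕ) :
    ∫⁻ s, (if s ≤ t then ENNReal.ofReal (poissonWeight r (t - s : ℝ≥0) n) else 0)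
      ∂expHolding r = ENNReal.ofReal (poissonWeight r t (n + 1)) := by
  have ht : (0 : ℝ) ≤ t := t.2
  have hm : Measurable fun s : ℝ≥0 => ENNReal.ofReal (poissonWeight r (t - s : ℝ≥0) n) := by
    unfold poissonWeight
    fun_prop
  rw [lintegral_expHolding r (Measurable.ite measurableSet_Iic hm measurable_const)]
  have hderiv : ∀ x ∈ Set.uIcc (0 : ℝ) t, HasDerivAt
      (fun x : ℝ => -(Real.exp (-(r * t)) * (r * (t - x)) ^ (n + 1) / (n + 1).factorial))
      (r * Real.exp (-(r * t)) * (r * (t - x)) ^ n / n.factorial) x := by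
    intro x _
    have h1 : HasDerivAt (fun x : ℝ => r * (t - x)) (-r) x := by
      simpa using ((hasDerivAt_id x).const_sub (t : ℝ)).const_mul r
    have h2 := (((h1.pow (n + 1)).const_mul (Real.exp (-(r * t)))).div_const
      ((n + 1).factorial : ℝ)).neg
    refine h2.congr_deriv ?_
    rw [Nat.factorial_succ]
    push_cast
    have : (n.factorial : ℝ) ≠ 0 := by positivity
    have : (n : ℝ) + 1 ≠ 0 := by positivity
    field_simp
  have hint : IntervalIntegrable
      (fun x : ℝ => r * Real.exp (-(r * t)) * (r * (t - x)) ^ n / n.factorial) volume 0 t :=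
    Continuous.intervalIntegrable (by fun_prop) _ _
  have hval := intervalIntegral.integral_eq_sub_of_hasDerivAt hderiv hint
  have hpos : 0 ≤ᵐ[volume.restrict (Set.Ioc (0 : ℝ) t)]
      fun x : ℝ => r * Real.exp (-(r * t)) * (r * (t - x)) ^ n / n.factorial := by
    filter_upwards [ae_restrict_mem measurableSet_Ioc] with x hx
    have : (0 : ℝ) ≤ t - x := sub_nonneg.mpr hx.2
    simp only [Pi.zero_apply]
    positivity
  rw [intervalIntegral.integral_of_le ht] at hval
  have hR : poissonWeight r t (n + 1) =
      ∫ x in Set.Ioc (0 : ℝ) t, r * Real.exp (-(r * t)) * (r * (t - x)) ^ n / n.factorial := by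
    rw [hval]; simp [poissonWeight]
  rw [hR, ofReal_integral_eq_lintegral_ofReal
      ((intervalIntegrable_iff_integrableOn_Ioc_of_le ht).mp hint) hpos,
    ← lintegral_indicator measurableSet_Ioc, ← lintegral_indicator measurableSet_Ioi]
  refine lintegral_congr fun x => ?_
  by_cases hx : 0 < x
  · by_cases hxt : x ≤ t
    · have h1 : x.toNNReal ≤ t := Real.toNNReal_le_iff_le_coe.mpr hxt
      have h2 : ((t - x.toNNReal : ℝ≥0) : ℝ) = t - x := by
        rw [NNReal.coe_sub h1, Real.coe_toNNReal _ hx.le]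
      simp only [Set.indicator, Set.mem_Ioi, Set.mem_Ioc, hx, hxt, and_self, if_true, h1, h2]
      rw [← ENNReal.ofReal_mul (by positivity), poissonWeight]
      congr 1
      have h3 : Real.exp (-(r * t)) = Real.exp (-(r * x)) * Real.exp (-(r * (t - x))) := by
        rw [← Real.exp_add]; ring_nf
      rw [h3]
      ring
    · have h1 : ¬ x.toNNReal ≤ t := by rwa [Real.toNNReal_le_iff_le_coe]
      simp [Set.indicator, hxt, h1]
  · simp [Set.indicator, hx]

/-! ### Infinite product measures on sequences -/

/-- The sequence `x, ω 0, ω 1, …`. -/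
def consSeq {E : Type*} (x : E) (ω : ℕ → E) : ℕ → E
  | 0 => x
  | n + 1 => ω n

lemma measurable_consSeq {E : Type*} [MeasurableSpace E] :
    Measurable fun p : E × (ℕ → E) => consSeq p.1 p.2 := by
  refine measurable_pi_iff.mpr fun n => ?_
  cases n with
  | zero => exact measurable_fst
  | succ n => exact (measurable_pi_apply n).comp measurable_snd

/-- Prepending an independent copy to an i.i.d. sequence keeps its law; it is enough to compare
finite-dimensional boxes. -/
lemma map_consSeq_infinitePi {E : Type*} [MeasurableSpace E] (q : Measure E)
    [IsProbabilityMeasure q] :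
    (q.prod (Measure.infinitePi fun _ : ℕ => q)).map (fun p => consSeq p.1 p.2) =
      Measure.infinitePi fun _ : ℕ => q := by
  classical
  refine Measure.eq_infinitePi _ fun s t ht => ?_
  rw [Measure.map_apply measurable_consSeq (.pi s.countable_toSet fun i _ => ht i)]
  -- The positive indices of `s`, shifted down by one.
  set s' : Finset ℕ := (Finset.range (s.sup id)).filter fun n => n + 1 ∈ s with hs'
  have hmem : ∀ n, n ∈ s' ↔ n + 1 ∈ s := fun n => by
    simp only [hs', Finset.mem_filter, Finset.mem_range, and_iff_right_iff_imp]
    exact fun h => Nat.lt_of_succ_le (Finset.le_sup (f := id) h)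
  have hpre : (fun p : E × (ℕ → E) => consSeq p.1 p.2) ⁻¹' Set.pi s t =
      (if 0 ∈ s then t 0 else Set.univ) ×ˢ Set.pi s' fun n => t (n + 1) := by
    ext p
    simp only [Set.mem_preimage, Set.mem_pi, Set.mem_prod, Finset.mem_coe, hmem]
    constructor
    · refine fun h => ⟨?_, fun n hn => h (n + 1) hn⟩
      split_ifs with h0
      · exact h 0 h0
      · trivial
    · rintro ⟨h0, h1⟩ n hn
      cases n with
      | zero => rwa [if_pos hn] at h0
      | succ n => exact h1 n hn
  rw [hpre, Measure.prod_prod, Measure.infinitePi_pi _ fun i _ => ht (i + 1)]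
  have hs : s.erase 0 = s'.map ⟨Nat.succ, Nat.succ_injective⟩ := by
    ext n
    cases n with
    | zero => simp
    | succ n => simp [hmem]
  have hprod : ∏ i ∈ s', q (t (i + 1)) = ∏ i ∈ s.erase 0, q (t i) := by
    rw [hs, Finset.prod_map]; rfl
  rw [hprod]
  split_ifs with h0
  · exact Finset.mul_prod_erase s (fun i => q (t i)) h0
  · rw [measure_univ, one_mul, Finset.erase_eq_of_notMem h0]

/-- Conditioning on the first coordinate, the engine of the inductions on the number of jumps below.
-/
lemma lintegral_infinitePi_nat {E : Type*} [MeasurableSpace E] (q : Measure E)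
    [IsProbabilityMeasure q] {F : (ℕ → E) → ℝ≥0∞} (hF : Measurable F) :
    ∫⁻ ω, F ω ∂(Measure.infinitePi fun _ : ℕ => q) =
      ∫⁻ x, ∫⁻ ω, F (consSeq x ω) ∂(Measure.infinitePi fun _ : ℕ => q) ∂q := by
  conv_lhs => rw [← map_consSeq_infinitePi q]
  rw [lintegral_map hF measurable_consSeq,
    lintegral_prod (fun p => F (consSeq p.1 p.2)) (hF.comp measurable_consSeq).aemeasurable]

/-! ### Jump processes driven by a sequence of holding times and marks -/

section JumpProcess

variable {Z M : Type*}

/-- The time of the `n`-th jump. -/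
def jumpTime (n : ℕ) (ω : ℕ → ℝ≥0 × M) : ℝ≥0 := ∑ i ∈ Finset.range n, (ω i).1

/-- The state after `n` jumps, for the initial state `z` and the jump map `φ`. -/
def skeleton (φ : Z → M → Z) : ℕ → Z → (ℕ → ℝ≥0 × M) → Z
  | 0, z, _ => z
  | n + 1, z, ω => φ (skeleton φ n z ω) (ω n).2

/-- The event that exactly `n` jumps have taken place at time `t`. -/
def jumpWindow (n : ℕ) (t : ℝ≥0) : Set (ℕ → ℝ≥0 × M) :=
  {ω | jumpTime n ω ≤ t ∧ t < jumpTime (n + 1) ω}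

/-- The residual holding time at time `t`, when `n` jumps have taken place, and the later holding
times, with their marks. -/
def restart (n : ℕ) (t : ℝ≥0) (ω : ℕ → ℝ≥0 × M) : ℕ → ℝ≥0 × M :=
  consSeq (jumpTime (n + 1) ω - t, (ω n).2) fun i => ω (n + 1 + i)

/-- The number of jumps until time `t`. -/
def jumpCount (t : ℝ≥0) (ω : ℕ → ℝ≥0 × M) : ℕ := sInf {n | t < jumpTime (n + 1) ω}

/-- The jump process with initial state `z`. -/
def jumpProcess (φ : Z → M → Z) (z : Z) (t : ℝ≥0) (ω : ℕ → ℝ≥0 × M) : Z :=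
  skeleton φ (jumpCount t ω) z ω

lemma jumpTime_mono (ω : ℕ → ℝ≥0 × M) : Monotone fun n => jumpTime n ω :=
  fun _ _ h => Finset.sum_le_sum_of_subset (Finset.range_mono h)

lemma jumpTime_succ_consSeq (n : ℕ) (x : ℝ≥0 × M) (ω : ℕ → ℝ≥0 × M) :
    jumpTime (n + 1) (consSeq x ω) = x.1 + jumpTime n ω := by
  simp only [jumpTime, Finset.sum_range_succ', add_comm x.1]
  rfl

lemma skeleton_succ_consSeq (φ : Z → M → Z) (n : ℕ) (z : Z) (x : ℝ≥0 × M)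
    (ω : ℕ → ℝ≥0 × M) :
    skeleton φ (n + 1) z (consSeq x ω) = skeleton φ n (φ z x.2) ω := by
  induction n with
  | zero => rfl
  | succ n ih => rw [skeleton, ih]; rfl

lemma skeleton_add (φ : Z → M → Z) (n j : ℕ) (z : Z) (ω ω' : ℕ → ℝ≥0 × M)
    (h : ∀ i, (ω' i).2 = (ω (n + i)).2) :
    skeleton φ (n + j) z ω = skeleton φ j (skeleton φ n z ω) ω' := by
  induction j with
  | zero => rfl
  | succ j ih => rw [← add_assoc, skeleton, ih, skeleton, h]

lemma consSeq_mem_jumpWindow_succ (n : ℕ) (t : ℝ≥0) (x : ℝ≥0 × M) (ω : ℕ → ℝ≥0 × M) :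
    consSeq x ω ∈ jumpWindow (n + 1) t ↔ x.1 ≤ t ∧ ω ∈ jumpWindow n (t - x.1) := by
  simp only [jumpWindow, Set.mem_ofPred_eq, jumpTime_succ_consSeq]
  constructor
  · rintro ⟨h1, h2⟩
    have h : x.1 ≤ t := le_self_add.trans h1
    exact ⟨h, (le_tsub_iff_left h).mpr h1, (tsub_lt_iff_left h).mpr h2⟩
  · rintro ⟨h, h1, h2⟩
    exact ⟨(le_tsub_iff_left h).mp h1, (tsub_lt_iff_left h).mp h2⟩

lemma restart_succ_consSeq (n : ℕ) (t : ℝ≥0) (x : ℝ≥0 × M) (ω : ℕ → ℝ≥0 × M)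
    (h : x.1 ≤ t) : restart (n + 1) t (consSeq x ω) = restart n (t - x.1) ω := by
  have h1 : jumpTime (n + 1 + 1) (consSeq x ω) - t = jumpTime (n + 1) ω - (t - x.1) := by
    rw [jumpTime_succ_consSeq]
    obtain ⟨s, rfl⟩ := exists_add_of_le h
    rw [add_tsub_add_eq_tsub_left, add_tsub_cancel_left]
  unfold restart
  rw [h1]
  congr 1
  funext i
  rw [show n + 1 + 1 + i = (n + 1 + i) + 1 by ring]
  rfl

lemma jumpTime_restart (n j : ℕ) (t : ℝ≥0) (ω : ℕ → ℝ≥0 × M) (h : ω ∈ jumpWindow n t) :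
    t + jumpTime (j + 1) (restart n t ω) = jumpTime (n + j + 1) ω := by
  rw [restart, jumpTime_succ_consSeq, ← add_assoc, add_tsub_cancel_of_le h.2.le]
  simp only [jumpTime]
  rw [show n + j + 1 = n + 1 + j by ring, Finset.sum_range_add _ (n + 1)]

lemma jumpCount_eq_iff {t : ℝ≥0} {ω : ℕ → ℝ≥0 × M} (h : ∃ n, t < jumpTime (n + 1) ω) (n : ℕ) :
    jumpCount t ω = n ↔ ω ∈ jumpWindow n t := by
  have key : ω ∈ jumpWindow (jumpCount t ω) t := by
    refine ⟨?_, Nat.sInf_mem h⟩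
    rcases hn : jumpCount t ω with _ | m
    · simp [jumpTime]
    · have : m ∉ {n | t < jumpTime (n + 1) ω} :=
        Nat.notMem_of_lt_sInf (by change m < jumpCount t ω; omega)
      simpa using this
  constructor
  · rintro rfl
    exact key
  · intro hn
    by_contra hne
    rcases lt_or_gt_of_ne hne with hlt | hlt
    · exact absurd (key.2.trans_le ((jumpTime_mono ω hlt).trans hn.1)) (lt_irrefl _)
    · exact absurd (hn.2.trans_le ((jumpTime_mono ω hlt).trans key.1)) (lt_irrefl _)

/-- Flow property: after time `t` the path is driven from the current state by the stream that
starts with the residual holding time. The interrupted holding time keeps its mark. -/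
lemma jumpProcess_add (φ : Z → M → Z) (z : Z) (s t : ℝ≥0) (ω : ℕ → ℝ≥0 × M)
    (h : ∀ t, ∃ n, t < jumpTime (n + 1) ω) :
    jumpProcess φ z (t + s) ω =
      jumpProcess φ (jumpProcess φ z t ω) s (restart (jumpCount t ω) t ω) := by
  set n := jumpCount t ω with hn
  have hw : ω ∈ jumpWindow n t := (jumpCount_eq_iff (h t) n).mp hn.symm
  have hr : ∀ j, t + jumpTime (j + 1) (restart n t ω) = jumpTime (n + j + 1) ω :=
    fun j => jumpTime_restart n j t ω hw
  have hex : ∃ j, s < jumpTime (j + 1) (restart n t ω) := by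
    obtain ⟨m, hm⟩ := h (t + s)
    refine ⟨m, ?_⟩
    have : t + s < jumpTime (n + m + 1) ω :=
      hm.trans_le (jumpTime_mono ω (show m + 1 ≤ n + m + 1 by omega))
    rw [← hr m] at this
    exact lt_of_add_lt_add_left this
  set j := jumpCount s (restart n t ω) with hj
  have hwj : restart n t ω ∈ jumpWindow j s := (jumpCount_eq_iff hex j).mp hj.symm
  have hc : jumpCount (t + s) ω = n + j := by
    rw [jumpCount_eq_iff (h _)]
    constructor
    · rcases j with _ | i
      · exact hw.1.trans le_self_add
      · have := hr i
        rw [← add_assoc, ← this]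
        exact add_le_add_right hwj.1 t
    · rw [← hr j]
      exact (add_lt_add_iff_left t).mpr hwj.2
  unfold jumpProcess
  rw [hc, ← hn, ← hj]
  refine skeleton_add φ n j z ω _ fun i => ?_
  cases i with
  | zero => rfl
  | succ i =>
    change (ω (n + 1 + i)).2 = _
    rw [add_right_comm, add_assoc]

/-- Paths of the jump process are right-continuous step functions with left limits. -/
lemma jumpProcess_cadlag (φ : Z → M → Z) (z : Z) (ω : ℕ → ℝ≥0 × M)
    (hω : ∀ t, ∃ n, t < jumpTime (n + 1) ω) (t : ℝ≥0) :
    (∀ᶠ s in 𝓝[>] t, jumpProcess φ z s ω = jumpProcess φ z t ω) ∧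
      ∃ x, ∀ᶠ s in 𝓝[<] t, jumpProcess φ z s ω = x := by
  have hval : ∀ n s, ω ∈ jumpWindow n s → jumpProcess φ z s ω = skeleton φ n z ω :=
    fun n s h => by rw [jumpProcess, (jumpCount_eq_iff (hω s) n).mpr h]
  constructor
  · have hn := (jumpCount_eq_iff (hω t) _).mp rfl
    filter_upwards [Ioo_mem_nhdsGT hn.2] with s hs
    exact hval _ s ⟨hn.1.trans hs.1.le, hs.2⟩
  · rcases eq_or_ne t 0 with rfl | ht
    · refine ⟨z, ?_⟩
      simp
    · classical
      -- The inequality is not strict: if `t` is itself a jump time, the left limit is the state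
      -- before the jump.
      have hex : ∃ n, t ≤ jumpTime (n + 1) ω := (hω t).imp fun n h => h.le
      set n := Nat.find hex with hn
      have h1 : t ≤ jumpTime (n + 1) ω := Nat.find_spec hex
      have h2 : jumpTime n ω < t := by
        rcases hn' : n with _ | k
        · simpa [jumpTime] using pos_iff_ne_zero.mpr ht
        · exact not_le.mp (Nat.find_min hex (show k < Nat.find hex by omega))
      refine ⟨skeleton φ n z ω, ?_⟩
      filter_upwards [Ioo_mem_nhdsLT h2] with s hs
      exact hval _ s ⟨hs.1.le, hs.2.trans_le h1⟩

variable [MeasurableSpace M]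

@[fun_prop]
lemma measurable_jumpTime (n : ℕ) : Measurable (jumpTime (M := M) n) := by
  unfold jumpTime
  fun_prop

lemma measurableSet_jumpWindow (n : ℕ) (t : ℝ≥0) : MeasurableSet (jumpWindow (M := M) n t) := by
  have h1 : MeasurableSet {ω : ℕ → ℝ≥0 × M | jumpTime n ω ≤ t} :=
    measurableSet_le (measurable_jumpTime n) measurable_const
  have h2 : MeasurableSet {ω : ℕ → ℝ≥0 × M | t < jumpTime (n + 1) ω} :=
    measurableSet_lt measurable_const (measurable_jumpTime (n + 1))
  exact h1.inter h2

lemma measurable_restart (n : ℕ) (t : ℝ≥0) : Measurable (restart (M := M) n t) := by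
  unfold restart
  refine measurable_consSeq.comp (Measurable.prodMk (Measurable.prodMk ?_ ?_) ?_)
  · exact (measurable_jumpTime (n + 1)).sub_const t
  · fun_prop
  · fun_prop

lemma measurable_jumpCount (t : ℝ≥0) : Measurable (jumpCount (M := M) t) := by
  have hlt : ∀ n, MeasurableSet {ω : ℕ → ℝ≥0 × M | t < jumpTime (n + 1) ω} := fun n =>
    measurableSet_lt measurable_const (measurable_jumpTime (n + 1))
  have hE : MeasurableSet {ω : ℕ → ℝ≥0 × M | ∃ n, t < jumpTime (n + 1) ω} := by
    rw [Set.ofPred_exists]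
    exact MeasurableSet.iUnion hlt
  refine measurable_to_countable' fun n => ?_
  have : jumpCount (M := M) t ⁻¹' {n} =
      ({ω | ∃ n, t < jumpTime (n + 1) ω} ∩ jumpWindow n t) ∪
        ({ω | ∃ n, t < jumpTime (n + 1) ω}ᶜ ∩ {_ω | n = 0}) := by
    ext ω
    by_cases h : ∃ n, t < jumpTime (n + 1) ω
    · simp only [Set.mem_preimage, Set.mem_singleton_iff, Set.mem_union, Set.mem_inter_iff,
        Set.mem_ofPred_eq, h, Set.mem_compl_iff, not_true_eq_false, true_and, false_and, or_false]
      exact jumpCount_eq_iff h n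
    -- If all jump times stay below `t`, the infimum is over the empty set and equals 0.
    · have h0 : jumpCount t ω = 0 := by
        have he : {n | t < jumpTime (n + 1) ω} = ∅ :=
          Set.eq_empty_of_forall_notMem fun m hm => h ⟨m, hm⟩
        rw [jumpCount, he, Nat.sInf_empty]
      simp only [Set.mem_preimage, Set.mem_singleton_iff, Set.mem_union, Set.mem_inter_iff,
        Set.mem_ofPred_eq, h, Set.mem_compl_iff, not_false_eq_true, true_and, false_and, false_or,
        h0, eq_comm]
  rw [this]
  exact (hE.inter (measurableSet_jumpWindow n t)).union (hE.compl.inter (MeasurableSet.const _))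

variable [MeasurableSpace Z] [Countable Z] [MeasurableSingletonClass Z]

lemma measurable_skeleton {φ : Z → M → Z} (hφ : ∀ z, Measurable (φ z)) (n : ℕ) :
    Measurable fun p : Z × (ℕ → ℝ≥0 × M) => skeleton φ n p.1 p.2 := by
  induction n with
  | zero => exact measurable_fst
  | succ n ih =>
    have h : Measurable fun p : Z × M => φ p.1 p.2 := measurable_from_prod_countable_right hφ
    exact h.comp (ih.prodMk (by fun_prop))

lemma measurable_jumpProcess {φ : Z → M → Z} (hφ : ∀ z, Measurable (φ z)) (t : ℝ≥0) :
    Measurable fun p : Z × (ℕ → ℝ≥0 × M) => jumpProcess φ p.1 t p.2 := by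
  have h : Measurable fun q : ℕ × (Z × (ℕ → ℝ≥0 × M)) => skeleton φ q.1 q.2.1 q.2.2 :=
    measurable_from_prod_countable_right fun n => measurable_skeleton hφ n
  exact h.comp (((measurable_jumpCount t).comp measurable_snd).prodMk measurable_id)

lemma measurable_jumpProcess_right {φ : Z → M → Z} (hφ : ∀ z, Measurable (φ z)) (z : Z)
    (t : ℝ≥0) : Measurable (jumpProcess φ z t) :=
  Measurable.of_uncurry_left (f := fun z ω => jumpProcess φ z t ω) (measurable_jumpProcess hφ t)

end JumpProcess

/-! ### Laws of jump processes with i.i.d. exponential holding times -/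

section JumpProcessLaw

lemma indicator_jumpWindow_consSeq {M : Type*} (n : ℕ) (t : ℝ≥0) (F : (ℕ → ℝ≥0 × M) → ℝ≥0∞)
    (x : ℝ≥0 × M) (ω : ℕ → ℝ≥0 × M) :
    (jumpWindow (n + 1) t).indicator F (consSeq x ω) =
      if x.1 ≤ t then (jumpWindow n (t - x.1)).indicator (fun ω => F (consSeq x ω)) ω else 0 := by
  by_cases h : x.1 ≤ t
  · by_cases h' : ω ∈ jumpWindow n (t - x.1)
    · rw [if_pos h, Set.indicator_of_mem h',
        Set.indicator_of_mem ((consSeq_mem_jumpWindow_succ n t x ω).mpr ⟨h, h'⟩)]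
    · rw [if_pos h, Set.indicator_of_notMem h', Set.indicator_of_notMem fun hc =>
        h' ((consSeq_mem_jumpWindow_succ n t x ω).mp hc).2]
  · rw [if_neg h, Set.indicator_of_notMem fun hc =>
        h ((consSeq_mem_jumpWindow_succ n t x ω).mp hc).1]

variable {Z M : Type*} [MeasurableSpace M] [MeasurableSpace Z] [Countable Z]
  [MeasurableSingletonClass Z]

/-- The law of a sequence of independent exponential holding times with rate `r` and independent
marks with law `m`. -/
def streamLaw (r : ℝ) (m : Measure M) : Measure (ℕ → ℝ≥0 × M) :=
  Measure.infinitePi fun _ : ℕ => (expHolding r).prod m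

/-- The one-step operator of the jump chain. -/
def stepOp (φ : Z → M → Z) (m : Measure M) (g : Z → ℝ≥0∞) (z : Z) : ℝ≥0∞ :=
  ∫⁻ u, g (φ z u) ∂m

variable {r : ℝ} {m : Measure M} [IsProbabilityMeasure m] {φ : Z → M → Z}

lemma isProbabilityMeasure_streamLaw (hr : 0 < r) : IsProbabilityMeasure (streamLaw r m) := by
  have := isProbabilityMeasure_expHolding hr
  unfold streamLaw
  infer_instance

lemma lintegral_streamLaw (hr : 0 < r) {F : (ℕ → ℝ≥0 × M) → ℝ≥0∞} (hF : Measurable F) :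
    ∫⁻ ω, F ω ∂streamLaw r m =
      ∫⁻ x, ∫⁻ ω, F (consSeq x ω) ∂streamLaw r m ∂(expHolding r).prod m := by
  have := isProbabilityMeasure_expHolding hr
  exact lintegral_infinitePi_nat _ hF

/-- No jump up to `t` means that the first holding time exceeds `t`; its residual is again
exponential and independent of the mark. -/
lemma lintegral_jumpWindow_zero (hr : 0 < r) {F : (ℕ → ℝ≥0 × M) → ℝ≥0∞} (hF : Measurable F) (t : ℝ≥0) :
    ∫⁻ ω, (jumpWindow 0 t).indicator (fun ω => F (restart 0 t ω)) ω ∂streamLaw r m =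
      ENNReal.ofReal (Real.exp (-(r * t))) * ∫⁻ ω, F ω ∂streamLaw r m := by
  have := isProbabilityMeasure_expHolding hr
  have := isProbabilityMeasure_streamLaw hr (m := m)
  have hFc : Measurable fun p : (ℝ≥0 × M) × (ℕ → ℝ≥0 × M) => F (consSeq p.1 p.2) :=
    hF.comp measurable_consSeq
  have hG : Measurable fun x : ℝ≥0 × M => ∫⁻ ω, F (consSeq x ω) ∂streamLaw r m :=
    hFc.lintegral_prod_right'
  have hg : Measurable fun s : ℝ≥0 => ∫⁻ u, ∫⁻ ω, F (consSeq (s, u) ω) ∂streamLaw r m ∂m :=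
    hG.lintegral_prod_right'
  have hG' : Measurable fun x : ℝ≥0 × M =>
      if t < x.1 then ∫⁻ ω, F (consSeq (x.1 - t, x.2) ω) ∂streamLaw r m else 0 :=
    Measurable.ite (measurableSet_lt measurable_const measurable_fst)
      (hG.comp ((measurable_fst.sub_const t).prodMk measurable_snd)) measurable_const
  have hFr : Measurable fun ω => F (restart 0 t ω) := hF.comp (measurable_restart 0 t)
  rw [lintegral_streamLaw hr (hFr.indicator (measurableSet_jumpWindow 0 t)), lintegral_streamLaw hr hF, lintegral_prod _ hG.aemeasurable,
    ← lintegral_expHolding_residual r t hg]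
  have hkey : ∀ x : ℝ≥0 × M, ∫⁻ ω, (jumpWindow 0 t).indicator (fun ω => F (restart 0 t ω))
      (consSeq x ω)
      ∂streamLaw r m =
      if t < x.1 then ∫⁻ ω, F (consSeq (x.1 - t, x.2) ω) ∂streamLaw r m else 0 := by
    intro x
    have hmem : ∀ ω, consSeq x ω ∈ jumpWindow 0 t ↔ t < x.1 := fun ω => by
      simp [jumpWindow, jumpTime, consSeq]
    have hres : ∀ ω, restart 0 t (consSeq x ω) = consSeq (x.1 - t, x.2) ω := fun ω => by
      unfold restart
      congr 1
      · simp [jumpTime, consSeq]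
      · funext i
        rw [show 0 + 1 + i = i + 1 by ring]
        rfl
    by_cases h : t < x.1
    · simp [Set.indicator, hmem, h, hres]
    · simp [Set.indicator, hmem, h]
  simp_rw [hkey]
  rw [lintegral_prod _ hG'.aemeasurable]
  refine lintegral_congr fun s => ?_
  by_cases h : t < s <;> simp [h]

/-- Memorylessness at a fixed time, on the event that `n` jumps have taken place. -/
lemma lintegral_jumpWindow_restart (hr : 0 < r) (hφ : ∀ z, Measurable (φ z))
    {F : Z → (ℕ → ℝ≥0 × M) → ℝ≥0∞} (hF : ∀ z, Measurable (F z))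
    (n : ℕ) (t : ℝ≥0) (z : Z) :
    ∫⁻ ω, (jumpWindow n t).indicator (fun ω => F (skeleton φ n z ω) (restart n t ω)) ω
      ∂streamLaw r m =
    ∫⁻ ω, (jumpWindow n t).indicator
      (fun ω => ∫⁻ ω', F (skeleton φ n z ω) ω' ∂streamLaw r m) ω ∂streamLaw r m := by
  have hFm : Measurable fun p : Z × (ℕ → ℝ≥0 × M) => F p.1 p.2 :=
    measurable_from_prod_countable_right hF
  have hsk : ∀ n z, Measurable fun ω => skeleton φ n z ω := fun n z =>
    (measurable_skeleton hφ n).comp (measurable_prodMk_left (x := z))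
  have hm1 : ∀ n t z, Measurable ((jumpWindow n t).indicator
      (fun ω => F (skeleton φ n z ω) (restart n t ω))) := fun n t z =>
    Measurable.indicator (hFm.comp ((hsk n z).prodMk (measurable_restart n t)))
      (measurableSet_jumpWindow n t)
  have hm2 : ∀ n t z, Measurable ((jumpWindow n t).indicator
      (fun ω => ∫⁻ ω', F (skeleton φ n z ω) ω' ∂streamLaw r m)) := fun n t z =>
    Measurable.indicator ((measurable_of_countable
      fun z => ∫⁻ ω', F z ω' ∂streamLaw r m).comp (hsk n z)) (measurableSet_jumpWindow n t)
  induction n generalizing t z with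
  | zero =>
    have h2 := lintegral_jumpWindow_zero hr (m := m)
      (F := fun _ => ∫⁻ ω', F z ω' ∂streamLaw r m) measurable_const t
    have := isProbabilityMeasure_streamLaw hr (m := m)
    simp only [lintegral_const, measure_univ, mul_one] at h2
    simp only [skeleton]
    rw [lintegral_jumpWindow_zero hr (hF z) t]
    exact h2.symm
  | succ n ih =>
    rw [lintegral_streamLaw hr (hm1 _ _ _), lintegral_streamLaw hr (hm2 _ _ _)]
    refine lintegral_congr fun x => ?_
    -- After a first jump at `x.1`, the remaining stream has to make `n` jumps in the remaining time
    -- `t - x.1`, from the state `φ z x.2`.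
    by_cases h : x.1 ≤ t
    · have := ih (t - x.1) (φ z x.2)
      simpa only [indicator_jumpWindow_consSeq, h, if_true,
        skeleton_succ_consSeq, restart_succ_consSeq _ _ _ _ h] using this
    · simp [indicator_jumpWindow_consSeq, h]

/-- The number of jumps is Poisson and independent of the marks, hence the product form. -/
lemma lintegral_jumpWindow_skeleton (hr : 0 < r) (hφ : ∀ z, Measurable (φ z))
    (g : Z → ℝ≥0∞) (n : ℕ) (t : ℝ≥0) (z : Z) :
    ∫⁻ ω, (jumpWindow n t).indicator (fun ω => g (skeleton φ n z ω)) ω ∂streamLaw r m =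
      ENNReal.ofReal (poissonWeight r t n) * (stepOp φ m)^[n] g z := by
  have := isProbabilityMeasure_expHolding hr
  have := isProbabilityMeasure_streamLaw hr (m := m)
  have hsk : ∀ n z, Measurable fun ω => skeleton φ n z ω := fun n z =>
    (measurable_skeleton hφ n).comp (measurable_prodMk_left (x := z))
  induction n generalizing t z with
  | zero =>
    have h2 := lintegral_jumpWindow_zero hr (m := m) (F := fun _ => g z) measurable_const t
    simp only [lintegral_const, measure_univ, mul_one] at h2
    simpa [skeleton, poissonWeight] using h2
  | succ n ih =>
    have hg : Measurable fun ω => g (skeleton φ (n + 1) z ω) :=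
      (measurable_of_countable g).comp (hsk _ z)
    rw [lintegral_streamLaw hr (hg.indicator (measurableSet_jumpWindow _ t)), Function.iterate_succ_apply', stepOp,
      ← lintegral_expHolding_poissonWeight hr, ← lintegral_prod_mul]
    · refine lintegral_congr fun x => ?_
      by_cases h : x.1 ≤ t
      · have := ih (t - x.1) (φ z x.2)
        rw [if_pos h, ← this]
        simp only [indicator_jumpWindow_consSeq, h, if_true, skeleton_succ_consSeq]
      · simp [indicator_jumpWindow_consSeq, h]
    · refine (Measurable.ite measurableSet_Iic ?_ measurable_const).aemeasurable
      unfold poissonWeight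
      fun_prop
    · exact ((measurable_of_countable _).comp (hφ z)).aemeasurable

/-- Non-explosion: for a fixed time the windows are disjoint, and their Poisson probabilities sum to
1. Integer times suffice. -/
lemma ae_exists_lt_jumpTime (hr : 0 < r) :
    ∀ᵐ ω ∂streamLaw r m, ∀ t, ∃ n, t < jumpTime (n + 1) ω := by
  have := isProbabilityMeasure_streamLaw hr (m := m)
  have hk : ∀ k : ℕ, ∀ᵐ ω ∂streamLaw r m, ∃ n, (k : ℝ≥0) < jumpTime (n + 1) ω := by
    intro k
    have hd : Pairwise (Function.onFun Disjoint fun n => jumpWindow (M := M) n (k : ℝ≥0)) := by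
      intro i j hij
      refine Set.disjoint_left.mpr fun ω hi hj => hij ?_
      have hex : ∃ n, (k : ℝ≥0) < jumpTime (n + 1) ω := ⟨i, hi.2⟩
      rw [← (jumpCount_eq_iff hex i).mpr hi, (jumpCount_eq_iff hex j).mpr hj]
    -- On a one-point state space the previous formula gives the probability of a window.
    have hone : ∀ n, (stepOp (fun (_ : Unit) (_ : M) => ()) m)^[n] (fun _ => 1) = fun _ => 1 := by
      intro n
      induction n with
      | zero => rfl
      | succ n ih => rw [Function.iterate_succ_apply', ih]; funext z; simp [stepOp]
    have hw : ∀ n, streamLaw r m (jumpWindow n (k : ℝ≥0)) =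
        ENNReal.ofReal (poissonWeight r k n) := by
      intro n
      have := lintegral_jumpWindow_skeleton hr (m := m) (φ := fun (_ : Unit) (_ : M) => ())
        (fun _ => measurable_const) (fun _ => 1) n (k : ℝ≥0) ()
      rw [hone] at this
      rw [← lintegral_indicator_one (measurableSet_jumpWindow n (k : ℝ≥0))]
      simpa [Pi.one_def] using this
    have hu : streamLaw r m (⋃ n, jumpWindow n (k : ℝ≥0)) = 1 := by
      rw [measure_iUnion hd fun n => measurableSet_jumpWindow n _]
      simp_rw [hw]
      have hs := hasSum_poissonWeight r k
      rw [← ENNReal.ofReal_tsum_of_nonneg (fun n => poissonWeight_nonneg hr.le k.cast_nonneg n)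
        hs.summable, hs.tsum_eq, ENNReal.ofReal_one]
    have hae : ∀ᵐ ω ∂streamLaw r m, ω ∈ ⋃ n, jumpWindow n (k : ℝ≥0) := by
      exact (mem_ae_iff_prob_eq_one₀ (MeasurableSet.iUnion fun n =>
        measurableSet_jumpWindow n _).nullMeasurableSet).mpr hu
    filter_upwards [hae] with ω hω
    obtain ⟨n, hn⟩ := Set.mem_iUnion.mp hω
    exact ⟨n, hn.2⟩
  filter_upwards [ae_all_iff.mpr hk] with ω hω t
  obtain ⟨k, hk⟩ := exists_nat_ge t
  obtain ⟨n, hn⟩ := hω k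
  exact ⟨n, hk.trans_lt hn⟩

lemma lintegral_eq_tsum_jumpWindow (hr : 0 < r)
    {G : (ℕ → ℝ≥0 × M) → ℝ≥0∞} {H : ℕ → (ℕ → ℝ≥0 × M) → ℝ≥0∞}
    (t : ℝ≥0) (hGH : ∀ ω, G ω = H (jumpCount t ω) ω) (hH : ∀ n, Measurable (H n)) :
    ∫⁻ ω, G ω ∂streamLaw r m =
      ∑' n, ∫⁻ ω, (jumpWindow n t).indicator (H n) ω ∂streamLaw r m := by
  rw [← lintegral_tsum fun n => ((hH n).indicator (measurableSet_jumpWindow n t)).aemeasurable]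
  refine lintegral_congr_ae ?_
  filter_upwards [ae_exists_lt_jumpTime hr] with ω hω
  rw [tsum_eq_single (jumpCount t ω), Set.indicator_of_mem, hGH]
  · exact (jumpCount_eq_iff (hω t) _).mp rfl
  · intro n hn
    refine Set.indicator_of_notMem (fun hmem => hn ?_) _
    exact ((jumpCount_eq_iff (hω t) n).mpr hmem).symm

/-- The Markov property of the jump process at a fixed time. -/
lemma lintegral_jumpProcess_restart (hr : 0 < r) (hφ : ∀ z, Measurable (φ z))
    {F : Z → (ℕ → ℝ≥0 × M) → ℝ≥0∞}
    (hF : ∀ z, Measurable (F z)) (t : ℝ≥0) (z : Z) :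
    ∫⁻ ω, F (jumpProcess φ z t ω) (restart (jumpCount t ω) t ω) ∂streamLaw r m =
      ∫⁻ ω, ∫⁻ ω', F (jumpProcess φ z t ω) ω' ∂streamLaw r m ∂streamLaw r m := by
  have hFm : Measurable fun p : Z × (ℕ → ℝ≥0 × M) => F p.1 p.2 :=
    measurable_from_prod_countable_right hF
  have hsk : ∀ n, Measurable fun ω => skeleton φ n z ω := fun n =>
    (measurable_skeleton hφ n).comp (measurable_prodMk_left (x := z))
  rw [lintegral_eq_tsum_jumpWindow hr
      (G := fun ω => F (jumpProcess φ z t ω) (restart (jumpCount t ω) t ω))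
      (H := fun n ω => F (skeleton φ n z ω) (restart n t ω)) t
      (fun ω => rfl) fun n => hFm.comp ((hsk n).prodMk (measurable_restart n t)),
    lintegral_eq_tsum_jumpWindow hr
      (G := fun ω => ∫⁻ ω', F (jumpProcess φ z t ω) ω' ∂streamLaw r m)
      (H := fun n ω => ∫⁻ ω', F (skeleton φ n z ω) ω' ∂streamLaw r m) t (fun ω => rfl)
      fun n => (measurable_of_countable fun z => ∫⁻ ω', F z ω' ∂streamLaw r m).comp (hsk n)]
  exact tsum_congr fun n => lintegral_jumpWindow_restart hr hφ hF n t z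

/-- The one-dimensional laws of the jump process. -/
lemma lintegral_jumpProcess (hr : 0 < r) (hφ : ∀ z, Measurable (φ z))
    (g : Z → ℝ≥0∞) (t : ℝ≥0) (z : Z) :
    ∫⁻ ω, g (jumpProcess φ z t ω) ∂streamLaw r m =
      ∑' n, ENNReal.ofReal (poissonWeight r t n) * (stepOp φ m)^[n] g z := by
  rw [lintegral_eq_tsum_jumpWindow hr (G := fun ω => g (jumpProcess φ z t ω))
    (H := fun n ω => g (skeleton φ n z ω)) t (fun ω => rfl)
    fun n => (measurable_of_countable g).comp
      ((measurable_skeleton hφ n).comp (measurable_prodMk_left (x := z)))]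
  exact tsum_congr fun n => lintegral_jumpWindow_skeleton hr hφ g n t z

end JumpProcessLaw

/-! ### Uniformization -/

/-- `K` is the transition operator of a discrete-time chain such that `L = r (K - 1)`. -/
structure IsUniformization {S : Type*} (L : (S → ℝ) → (S → ℝ)) (r : ℝ)
    (K : (S → ℝ) →ₗ[ℝ] (S → ℝ)) : Prop where
  gen : ∀ f x, L f x = r * (K f x - f x)
  nonneg : ∀ f, (∀ x, 0 ≤ f x) → ∀ x, 0 ≤ K f x
  one : K (fun _ => 1) = fun _ => 1

section Uniformization

variable {S : Type*} {L : (S → ℝ) → (S → ℝ)} {r : ℝ} {K : (S → ℝ) →ₗ[ℝ] (S → ℝ)}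

lemma IsUniformization.iterate_mem_Icc (h : IsUniformization L r K) {f : S → ℝ}
    (hf : ∀ x, f x ∈ Set.Icc (0 : ℝ) 1) (n : ℕ) (x : S) : K^[n] f x ∈ Set.Icc (0 : ℝ) 1 := by
  induction n generalizing x with
  | zero => exact hf x
  | succ n ih =>
    rw [Function.iterate_succ_apply']
    refine ⟨h.nonneg _ (fun x => (ih x).1) x, ?_⟩
    have h1 := h.nonneg ((fun _ => 1) - K^[n] f) (fun x => sub_nonneg.mpr (ih x).2) x
    rw [map_sub, h.one] at h1
    exact sub_nonneg.mp h1

/-- Binomial theorem for `r K - r`, whose two terms commute. -/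
lemma IsUniformization.iterate_eq (h : IsUniformization L r K) (f : S → ℝ) (n : ℕ) (x : S) :
    L^[n] f x = ∑ p ∈ Finset.HasAntidiagonal.antidiagonal n,
      (n.choose p.1 : ℝ) * (r ^ p.1 * (-r) ^ p.2 * K^[p.1] f x) := by
  set T : Module.End ℝ (S → ℝ) := r • K + (-r) • 1 with hT
  have hL : L = T := by
    funext f x
    rw [h.gen, hT]
    simp
    ring
  have hc : Commute (r • K : Module.End ℝ (S → ℝ)) ((-r) • 1) :=
    ((Commute.one_right K).smul_left r).smul_right (-r)
  rw [hL, ← Module.End.coe_pow, hT, hc.add_pow', LinearMap.sum_apply, Finset.sum_apply]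
  refine Finset.sum_congr rfl fun p _ => ?_
  rw [smul_pow, smul_pow, one_pow, ← Module.End.coe_pow]
  simp [mul_assoc, mul_left_comm]

variable [DecidableEq S]

/-- The transition function of a uniformizable chain, as a Poisson mixture. -/
lemma IsUniformization.transProb_eq (h : IsUniformization L r K) (t : ℝ) (x y : S) :
    transProb L t x y =
      ∑' n, poissonWeight r t n * K^[n] (fun z => if z = y then 1 else 0) x := by
  set f : S → ℝ := fun z => if z = y then 1 else 0 with hf
  have hf01 : ∀ x, f x ∈ Set.Icc (0 : ℝ) 1 := fun x => by
    simp only [hf]; split_ifs <;> simp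
  have hb : ∀ n, ‖K^[n] f x‖ ≤ 1 := fun n => by
    have := h.iterate_mem_Icc hf01 n x
    rw [Real.norm_of_nonneg this.1]
    exact this.2
  have hexp : ∀ s : ℝ, Summable fun n : ℕ => ‖s ^ n / (n.factorial : ℝ)‖ := fun s => by
    simpa using Real.summable_pow_div_factorial ‖s‖
  have ha : Summable fun n : ℕ => ‖(r * t) ^ n / (n.factorial : ℝ) * K^[n] f x‖ := by
    refine Summable.of_nonneg_of_le (fun _ => norm_nonneg _) (fun n => ?_) (hexp (r * t))
    rw [norm_mul]
    exact mul_le_of_le_one_right (norm_nonneg _) (hb n)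
  -- This is `exp (t L) = e^{-rt} exp (r t K)` as a Cauchy product; absolute convergence comes from
  -- `0 ≤ K^n f ≤ 1`.
  have hprod := tsum_mul_tsum_eq_tsum_sum_antidiagonal_of_summable_norm ha (hexp (-(r * t)))
  have hsum : ∑' n : ℕ, (-(r * t)) ^ n / (n.factorial : ℝ) = Real.exp (-(r * t)) := by
    rw [Real.exp_eq_exp_ℝ, NormedSpace.exp_eq_tsum_div]
  rw [hsum, mul_comm, ← tsum_mul_left] at hprod
  have hR : ∑' n, poissonWeight r t n * K^[n] f x =
      ∑' n : ℕ, Real.exp (-(r * t)) * ((r * t) ^ n / (n.factorial : ℝ) * K^[n] f x) :=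
    tsum_congr fun n => by rw [poissonWeight]; ring
  rw [hR, hprod, transProb]
  refine tsum_congr fun n => ?_
  rw [h.iterate_eq, Finset.mul_sum]
  refine Finset.sum_congr rfl fun p hp => ?_
  obtain rfl := Finset.HasAntidiagonal.mem_antidiagonal.mp hp
  have hfac : ((p.1 + p.2).choose p.1 : ℝ) =
      (p.1 + p.2).factorial / (p.1.factorial * p.2.factorial) := by
    rw [Nat.cast_add_choose]
  rw [hfac, neg_mul_eq_neg_mul, mul_pow, mul_pow, pow_add]
  have h1 : ((p.1 + p.2).factorial : ℝ) ≠ 0 := by positivity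
  have h2 : (p.1.factorial : ℝ) ≠ 0 := by positivity
  have h3 : (p.2.factorial : ℝ) ≠ 0 := by positivity
  change _ = _ / _ * K^[p.1] (fun z => if z = y then 1 else 0) x * _
  field_simp

lemma IsUniformization.transProb_nonneg (h : IsUniformization L r K) (hr : 0 ≤ r) {t : ℝ}
    (ht : 0 ≤ t) (x y : S) : 0 ≤ transProb L t x y := by
  rw [h.transProb_eq]
  refine tsum_nonneg fun n => mul_nonneg (poissonWeight_nonneg hr ht n)
    (h.iterate_mem_Icc (fun x => ?_) n x).1
  split_ifs <;> simp

lemma transProb_zero (L : (S → ℝ) → (S → ℝ)) (x y : S) :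
    transProb L 0 x y = if x = y then 1 else 0 := by
  rw [transProb, tsum_eq_single 0 fun n hn => by simp [hn]]
  simp

end Uniformization

/-! ### Projections of jump processes that are Markov chains -/

section Projection

variable {Z M S : Type*} [MeasurableSpace M] [MeasurableSpace Z] [Countable Z]
  [MeasurableSingletonClass Z] [DecidableEq S] {L : (S → ℝ) → (S → ℝ)} {r : ℝ}
  {K : (S → ℝ) →ₗ[ℝ] (S → ℝ)} {m : Measure M} [IsProbabilityMeasure m] {φ : Z → M → Z}

/-- `hstep` is the lumpability condition: the law of the image of a step depends on `z` only through
`p z`. Thus the iterates of `stepOp` on functions of `p` are those of `K`, and the Poisson mixtures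
agree. -/
lemma streamLaw_jumpProcess_eq (hr : 0 < r) (hφ : ∀ z, Measurable (φ z))
    (hK : IsUniformization L r K) (p : Z → S)
    (hstep : ∀ f : S → ℝ, (∀ x, 0 ≤ f x) → ∀ z,
      ∫⁻ u, ENNReal.ofReal (f (p (φ z u))) ∂m = ENNReal.ofReal (K f (p z)))
    (t : ℝ≥0) (z : Z) (y : S) :
    streamLaw r m {ω | p (jumpProcess φ z t ω) = y} = ENNReal.ofReal (transProb L t (p z) y) := by
  set f : S → ℝ := fun z => if z = y then 1 else 0 with hf
  have hf01 : ∀ x, f x ∈ Set.Icc (0 : ℝ) 1 := fun x => by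
    simp only [hf]; split_ifs <;> simp
  have hX : Measurable (jumpProcess φ z t) := measurable_jumpProcess_right hφ z t
  have hset : MeasurableSet {ω | p (jumpProcess φ z t ω) = y} :=
    hX (Set.to_countable {z' : Z | p z' = y}).measurableSet
  have hit : ∀ n, (stepOp φ m)^[n] (fun z => ENNReal.ofReal (f (p z))) =
      fun z => ENNReal.ofReal (K^[n] f (p z)) := by
    intro n
    induction n with
    | zero => rfl
    | succ n ih =>
      rw [Function.iterate_succ_apply', ih]
      funext z
      rw [stepOp, hstep _ (fun x => (hK.iterate_mem_Icc hf01 n x).1), Function.iterate_succ_apply']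
  have h1 := lintegral_jumpProcess hr hφ (m := m) (fun z => ENNReal.ofReal (f (p z))) t z
  rw [← lintegral_indicator_one hset]
  have h2 : ∀ ω, {ω | p (jumpProcess φ z t ω) = y}.indicator (1 : (ℕ → ℝ≥0 × M) → ℝ≥0∞) ω =
      ENNReal.ofReal (f (p (jumpProcess φ z t ω))) := fun ω => by
    simp only [Set.indicator, Set.mem_ofPred_eq, hf]
    split_ifs <;> simp
  simp_rw [h2]
  have hnn : ∀ n, 0 ≤ poissonWeight r t n * K^[n] f (p z) := fun n =>
    mul_nonneg (poissonWeight_nonneg hr.le t.coe_nonneg n) (hK.iterate_mem_Icc hf01 n _).1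
  rw [h1, hK.transProb_eq, ENNReal.ofReal_tsum_of_nonneg hnn]
  · refine tsum_congr fun n => ?_
    rw [hit, ENNReal.ofReal_mul (poissonWeight_nonneg hr.le t.coe_nonneg n)]
  · exact Summable.of_nonneg_of_le hnn (fun n => mul_le_of_le_one_right
      (poissonWeight_nonneg hr.le t.coe_nonneg n) (hK.iterate_mem_Icc hf01 n _).2)
      (hasSum_poissonWeight r t).summable

/-- The finite-dimensional distributions of the projected process. -/
lemma streamLaw_jumpProcess_forall (hr : 0 < r) (hφ : ∀ z, Measurable (φ z))
    (hK : IsUniformization L r K) (p : Z → S)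
    (hstep : ∀ f : S → ℝ, (∀ x, 0 ≤ f x) → ∀ z,
      ∫⁻ u, ENNReal.ofReal (f (p (φ z u))) ∂m = ENNReal.ofReal (K f (p z)))
    (n : ℕ) (t : ℕ → ℝ≥0) (ht : Monotone t) (x : ℕ → S) (z : Z) :
    streamLaw r m {ω | ∀ i ≤ n, p (jumpProcess φ z (t i) ω) = x i} =
      ENNReal.ofReal (transProb L (t 0) (p z) (x 0)) * ∏ i ∈ Finset.range n,
        ENNReal.ofReal (transProb L ((t (i + 1) : ℝ) - t i) (x i) (x (i + 1))) := by
  induction n generalizing t x z with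
  | zero =>
    simp only [Nat.le_zero, forall_eq, Finset.range_zero, Finset.prod_empty, mul_one]
    exact streamLaw_jumpProcess_eq hr hφ hK p hstep (t 0) z (x 0)
  | succ n ih =>
    have hX : ∀ z t, Measurable (jumpProcess φ z t) := measurable_jumpProcess_right hφ
    have hset : ∀ z t y, MeasurableSet {ω | p (jumpProcess φ z t ω) = y} := fun z t y =>
      hX z t (Set.to_countable {z' : Z | p z' = y}).measurableSet
    have hsets : ∀ (z : Z) (n : ℕ) (t : ℕ → ℝ≥0) (x : ℕ → S),
        MeasurableSet {ω | ∀ i ≤ n, p (jumpProcess φ z (t i) ω) = x i} := fun z n t x => by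
      simp only [Set.ofPred_forall]
      exact MeasurableSet.iInter fun i => MeasurableSet.iInter fun _ => hset _ _ _
    -- The induction hypothesis is applied to the process restarted at time `t 0`.
    set t' : ℕ → ℝ≥0 := fun i => t (i + 1) - t 0 with ht'
    set x' : ℕ → S := fun i => x (i + 1) with hx'
    set B : Z → Set (ℕ → ℝ≥0 × M) :=
      fun z' => {ω | ∀ i ≤ n, p (jumpProcess φ z' (t' i) ω) = x' i} with hB
    set F : Z → (ℕ → ℝ≥0 × M) → ℝ≥0∞ := fun z' ω =>
      if p z' = x 0 then (B z').indicator 1 ω else 0 with hF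
    have hFm : ∀ z', Measurable (F z') := fun z' => by
      by_cases h : p z' = x 0
      · simp only [hF, h, if_true]
        exact measurable_one.indicator (hsets z' n t' x')
      · simp only [hF, h, if_false]
        exact measurable_const
    set c : ℝ≥0∞ := ∏ i ∈ Finset.range (n + 1),
        ENNReal.ofReal (transProb L ((t (i + 1) : ℝ) - t i) (x i) (x (i + 1))) with hc
    have hle : ∀ i, t 0 ≤ t i := fun i => ht (Nat.zero_le i)
    have hFint : ∀ z', ∫⁻ ω, F z' ω ∂streamLaw r m =
        c * {z' | p z' = x 0}.indicator 1 z' := fun z' => by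
      by_cases h : p z' = x 0
      · have h1 : {z' | p z' = x 0}.indicator (1 : Z → ℝ≥0∞) z' = 1 :=
          Set.indicator_of_mem (s := {z' | p z' = x 0}) h _
        simp only [hF, h, if_true]
        rw [h1, mul_one, lintegral_indicator_one (hsets z' n t' x'),
          ih t' (fun i j hij => tsub_le_tsub_right (ht (Nat.succ_le_succ hij)) _) x' z', h,
          hc, Finset.prod_range_succ', mul_comm]
        simp only [ht', hx', NNReal.coe_sub (hle _), sub_sub_sub_cancel_right, zero_add]
      · simp [hF, h]
    have h0 : ∫⁻ ω, {z' | p z' = x 0}.indicator (1 : Z → ℝ≥0∞) (jumpProcess φ z (t 0) ω)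
        ∂streamLaw r m = streamLaw r m {ω | p (jumpProcess φ z (t 0) ω) = x 0} :=
      lintegral_indicator_one (hset z (t 0) (x 0))
    have hae : ∀ᵐ ω ∂streamLaw r m,
        {ω | ∀ i ≤ n + 1, p (jumpProcess φ z (t i) ω) = x i}.indicator (1 : (ℕ → ℝ≥0 × M) → ℝ≥0∞) ω =
        F (jumpProcess φ z (t 0) ω) (restart (jumpCount (t 0) ω) (t 0) ω) := by
      filter_upwards [ae_exists_lt_jumpTime hr] with ω hω
      have hiff : ω ∈ {ω | ∀ i ≤ n + 1, p (jumpProcess φ z (t i) ω) = x i} ↔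
          p (jumpProcess φ z (t 0) ω) = x 0 ∧
            restart (jumpCount (t 0) ω) (t 0) ω ∈ B (jumpProcess φ z (t 0) ω) := by
        have hshift : ∀ i, jumpProcess φ (jumpProcess φ z (t 0) ω) (t' i)
            (restart (jumpCount (t 0) ω) (t 0) ω) = jumpProcess φ z (t (i + 1)) ω := fun i => by
          rw [← jumpProcess_add φ z (t' i) (t 0) ω hω, ht', add_tsub_cancel_of_le (hle _)]
        simp only [hB, Set.mem_ofPred_eq, hshift, hx']
        constructor
        · exact fun h => ⟨h 0 (Nat.zero_le _), fun i hi => h (i + 1) (Nat.succ_le_succ hi)⟩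
        · rintro ⟨h1, h2⟩ i hi
          cases i with
          | zero => exact h1
          | succ i => exact h2 i (Nat.le_of_succ_le_succ hi)
      by_cases h1 : p (jumpProcess φ z (t 0) ω) = x 0
      · simp only [hF, if_pos h1]
        by_cases h2 : restart (jumpCount (t 0) ω) (t 0) ω ∈ B (jumpProcess φ z (t 0) ω)
        · rw [Set.indicator_of_mem h2, Set.indicator_of_mem (hiff.mpr ⟨h1, h2⟩)]; rfl
        · rw [Set.indicator_of_notMem h2, Set.indicator_of_notMem fun h => h2 (hiff.mp h).2]
      · simp only [hF, if_neg h1]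
        exact Set.indicator_of_notMem (fun h => h1 (hiff.mp h).1) _
    rw [← lintegral_indicator_one (hsets z (n + 1) t x), lintegral_congr_ae hae,
      lintegral_jumpProcess_restart hr hφ hFm (t 0) z]
    simp_rw [hFint]
    have hm0 : Measurable fun ω =>
        {z' | p z' = x 0}.indicator (1 : Z → ℝ≥0∞) (jumpProcess φ z (t 0) ω) :=
      (measurable_of_countable ({z' | p z' = x 0}.indicator (1 : Z → ℝ≥0∞))).comp (hX z (t 0))
    rw [lintegral_const_mul _ hm0, h0,
      streamLaw_jumpProcess_eq hr hφ hK p hstep, mul_comm]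

lemma isMarkovChain_jumpProcess [MeasurableSpace S] [MeasurableSingletonClass S] (hr : 0 < r)
    (hφ : ∀ z, Measurable (φ z)) (hK : IsUniformization L r K) (p : Z → S)
    (hstep : ∀ f : S → ℝ, (∀ x, 0 ≤ f x) → ∀ z,
      ∫⁻ u, ENNReal.ofReal (f (p (φ z u))) ∂m = ENNReal.ofReal (K f (p z))) (init : PMF Z) :
    IsMarkovChain L (init.map p) (init.toMeasure.prod (streamLaw r m))
      fun t w => p (jumpProcess φ w.1 t w.2) := by
  have := isProbabilityMeasure_streamLaw hr (m := m)
  have hX : ∀ t, Measurable fun w : Z × (ℕ → ℝ≥0 × M) => p (jumpProcess φ w.1 t w.2) := fun t =>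
    (measurable_of_countable p).comp (measurable_jumpProcess hφ t)
  have hsets : ∀ (n : ℕ) (t : ℕ → ℝ≥0) (x : ℕ → S),
      MeasurableSet {w : Z × (ℕ → ℝ≥0 × M) | ∀ i ≤ n, p (jumpProcess φ w.1 (t i) w.2) = x i} :=
    fun n t x => by
      simp only [Set.ofPred_forall]
      exact MeasurableSet.iInter fun i => MeasurableSet.iInter fun _ =>
        hX (t i) (measurableSet_singleton (x i))
  have hfdd : ∀ (n : ℕ) (t : ℕ → ℝ≥0), Monotone t → ∀ x : ℕ → S,
      (init.toMeasure.prod (streamLaw r m))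
        {w : Z × (ℕ → ℝ≥0 × M) | ∀ i ≤ n, p (jumpProcess φ w.1 (t i) w.2) = x i} =
      ∫⁻ z, ENNReal.ofReal (transProb L (t 0) (p z) (x 0)) * ∏ i ∈ Finset.range n,
        ENNReal.ofReal (transProb L ((t (i + 1) : ℝ) - t i) (x i) (x (i + 1)))
        ∂init.toMeasure := fun n t ht x => by
    rw [Measure.prod_apply (hsets n t x)]
    exact lintegral_congr fun z => streamLaw_jumpProcess_forall hr hφ hK p hstep n t ht x z
  refine ⟨hX, ?_, ?_, ?_⟩
  · have h := Measure.quasiMeasurePreserving_snd (μ := init.toMeasure)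
      (ν := streamLaw r m) |>.ae (ae_exists_lt_jumpTime hr)
    filter_upwards [h] with w hw t
    obtain ⟨h1, x, h2⟩ := jumpProcess_cadlag φ w.1 w.2 hw t
    exact ⟨h1.mono fun s hs => by rw [hs], p x, h2.mono fun s hs => by rw [hs]⟩
  · intro x
    have h := hfdd 0 (fun _ => 0) monotone_const (fun _ => x)
    simp only [Nat.le_zero, forall_eq, Finset.range_zero, Finset.prod_empty, mul_one,
      NNReal.coe_zero, transProb_zero] at h
    have hpx : MeasurableSet {z | p z = x} := (Set.to_countable _).measurableSet
    rw [h, ← PMF.toMeasure_apply_singleton (init.map p) x (measurableSet_singleton x),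
      ← PMF.toMeasure_map p init (measurable_of_countable p),
      Measure.map_apply (measurable_of_countable p) (measurableSet_singleton x)]
    change _ = init.toMeasure {z | p z = x}
    rw [← lintegral_indicator_one hpx]
    refine lintegral_congr fun z => ?_
    simp only [Set.indicator, Set.mem_ofPred_eq]
    split_ifs <;> simp
  · intro n t ht x
    have hd : (0 : ℝ) ≤ (t (n + 1) : ℝ) - t n :=
      sub_nonneg.mpr (NNReal.coe_le_coe.mpr (ht (Nat.le_succ n)))
    rw [measureReal_def, measureReal_def, hfdd (n + 1) t ht x, hfdd n t ht x]
    -- The last transition factor does not depend on the initial state and leaves the integral.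
    simp_rw [Finset.prod_range_succ, ← mul_assoc]
    rw [lintegral_mul_const _ (measurable_of_countable _), ENNReal.toReal_mul,
      ENNReal.toReal_ofReal (hK.transProb_nonneg hr.le hd _ _)]

end Projection

/-! ### Tail sums and their order -/

section TailSums

variable {N : ℕ}

/-- The number of jobs in positions `≥ m`, summed over the servers. -/
def excess (q : Fin N → ℕ) (m : ℕ) : ℕ := ∑ n, (q n + 1 - m)

/-- Order of configurations by tail sums. -/
def TailLE (q q' : Fin N → ℕ) : Prop := ∀ m, 1 ≤ m → excess q m ≤ excess q' m

lemma occupancy_eq_sum (q : Fin N → ℕ) (i : ℕ) :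
    occupancy q i = ∑ n, if i ≤ q n then 1 else 0 := by
  rw [occupancy, Finset.card_filter]

/-- Double counting of pairs of a server and a position; positions beyond the total number of jobs
are empty, so the series is finite. -/
lemma tailSums_eq_excess (q : Fin N → ℕ) (m : ℕ+) : tailSums q m = excess q m := by
  have hb : ∀ n, q n ≤ ∑ n, q n := fun n => Finset.single_le_sum (fun _ _ => Nat.zero_le _)
    (Finset.mem_univ n)
  set B := ∑ n, q n
  have hpos : 1 ≤ (m : ℕ) := m.pos
  rw [tailSums, tsum_eq_sum (s := Finset.range (B + 1)) (fun j hj => ?_)]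
  · simp_rw [occupancy_eq_sum]
    rw [Finset.sum_comm]
    refine Finset.sum_congr rfl fun n _ => ?_
    rw [← Finset.card_filter]
    have : (Finset.range (B + 1)).filter (fun j => (m : ℕ) + j ≤ q n) =
        Finset.range (q n + 1 - m) := by
      ext j
      have := hb n
      simp only [Finset.mem_filter, Finset.mem_range]
      omega
    rw [this, Finset.card_range]
  · rw [occupancy_eq_sum]
    refine Finset.sum_eq_zero fun n _ => if_neg ?_
    have := hb n
    simp only [Finset.mem_range] at hj
    omega

lemma forall_tailSums_le_iff (q q' : Fin N → ℕ) :
    (∀ m, tailSums q m ≤ tailSums q' m) ↔ TailLE q q' := by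
  simp only [tailSums_eq_excess]
  exact ⟨fun h m hm => h ⟨m, hm⟩, fun h m => h m m.pos⟩

/-- Used to turn equality at one level and the inequality at a neighbouring level into a comparison
of occupancies. -/
lemma excess_eq_add (q : Fin N → ℕ) (m : ℕ) : excess q m = occupancy q m + excess q (m + 1) := by
  rw [excess, excess, occupancy_eq_sum, ← Finset.sum_add_distrib]
  refine Finset.sum_congr rfl fun n _ => ?_
  split_ifs <;> omega

lemma excess_update (q : Fin N → ℕ) (u : Fin N) (a m : ℕ) :
    excess (Function.update q u a) m + (q u + 1 - m) = excess q m + (a + 1 - m) := by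
  have h1 := Finset.add_sum_erase Finset.univ
    (fun n => Function.update q u a n + 1 - m) (Finset.mem_univ u)
  have h2 := Finset.add_sum_erase Finset.univ (fun n => q n + 1 - m) (Finset.mem_univ u)
  have h3 : ∑ n ∈ Finset.univ.erase u, (Function.update q u a n + 1 - m) =
      ∑ n ∈ Finset.univ.erase u, (q n + 1 - m) :=
    Finset.sum_congr rfl fun n hn => by rw [Function.update_of_ne (Finset.ne_of_mem_erase hn)]
  simp only [Function.update_self] at h1
  unfold excess
  omega

/-- Each excess grows by 0 or 1, so only the levels with equality need a condition. -/
lemma TailLE.update_succ {q q' : Fin N → ℕ} (h : TailLE q q') {u u' : Fin N}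
    (hu : ∀ m, 1 ≤ m → excess q m = excess q' m → m ≤ q u + 1 → m ≤ q' u' + 1) :
    TailLE (Function.update q u (q u + 1)) (Function.update q' u' (q' u' + 1)) := by
  intro m hm
  have h1 := excess_update q u (q u + 1) m
  have h2 := excess_update q' u' (q' u' + 1) m
  have h3 := h m hm
  have h4 := hu m hm
  omega

lemma TailLE.right_update_succ {q q' : Fin N → ℕ} (h : TailLE q q') (u' : Fin N) :
    TailLE q (Function.update q' u' (q' u' + 1)) := by
  intro m hm
  have h2 := excess_update q' u' (q' u' + 1) m
  have h3 := h m hm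
  omega

/-- Departure analogue; truncated subtraction makes a departure from an empty queue void. -/
lemma TailLE.update_pred {q q' : Fin N → ℕ} (h : TailLE q q') {u u' : Fin N}
    (hu : ∀ m, 1 ≤ m → excess q m = excess q' m → m ≤ q' u' → m ≤ q u) :
    TailLE (Function.update q u (q u - 1)) (Function.update q' u' (q' u' - 1)) := by
  intro m hm
  have h1 := excess_update q u (q u - 1) m
  have h2 := excess_update q' u' (q' u' - 1) m
  have h3 := h m hm
  have h4 := hu m hm
  omega

/-- The matching of two families by rank. -/
lemma exists_perm_rank_matching {ι : Type*} [Fintype ι] (f g : ι → ℕ) :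
    ∃ σ : Equiv.Perm ι, ∀ m, (Finset.univ.filter fun i => m ≤ f i).card ≤
      (Finset.univ.filter fun i => m ≤ g i).card → ∀ i, m ≤ f i → m ≤ g (σ i) := by
  set n := Fintype.card ι
  let a : Fin n ≃ ι := (Tuple.sort (f ∘ (Fintype.equivFin ι).symm)).trans (Fintype.equivFin ι).symm
  let b : Fin n ≃ ι := (Tuple.sort (g ∘ (Fintype.equivFin ι).symm)).trans (Fintype.equivFin ι).symm
  have ha : Monotone (f ∘ a) := Tuple.monotone_sort (f ∘ (Fintype.equivFin ι).symm)
  have hb : Monotone (g ∘ b) := Tuple.monotone_sort (g ∘ (Fintype.equivFin ι).symm)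
  refine ⟨a.symm.trans b, fun m hm i hi => ?_⟩
  -- In rank `s`, all ranks from `s` on have `f ≥ m`, while `g ≥ m` only occurs strictly above `s`.
  -- This contradicts the comparison of the counts.
  by_contra hlt
  set s := a.symm i with hs
  have h1 : (Finset.Ici s).card ≤ (Finset.univ.filter fun i => m ≤ f i).card := by
    refine Finset.card_le_card_of_injOn a (fun s' hs' => ?_) a.injective.injOn
    have hle : f (a s) ≤ f (a s') := ha (Finset.mem_Ici.mp hs')
    rw [hs, Equiv.apply_symm_apply] at hle
    simpa using hi.trans hle
  have h2 : (Finset.univ.filter fun i => m ≤ g i).card ≤ (Finset.Ioi s).card := by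
    refine Finset.card_le_card_of_injOn b.symm (fun j hj => ?_) b.symm.injective.injOn
    rw [Finset.mem_coe, Finset.mem_Ioi]
    by_contra hjs
    have hle : g (b (b.symm j)) ≤ g (b s) := hb (not_lt.mp hjs)
    rw [Equiv.apply_symm_apply] at hle
    simp only [Finset.coe_filter, Finset.mem_univ, true_and, Set.mem_ofPred_eq] at hj
    exact hlt (hj.trans hle)
  rw [Fin.card_Ici] at h1
  rw [Fin.card_Ioi] at h2
  have := s.isLt
  omega

/-- Simultaneous departures at servers with the same rank preserve the order. -/
lemma TailLE.exists_departure_matching {q q' : Fin N → ℕ} (h : TailLE q q') :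
    ∃ σ : Equiv.Perm (Fin N), ∀ n,
      TailLE (Function.update q n (q n - 1)) (Function.update q' (σ n) (q' (σ n) - 1)) := by
  obtain ⟨σ, hσ⟩ := exists_perm_rank_matching q' q
  refine ⟨σ.symm, fun n => h.update_pred fun m hm heq hle => ?_⟩
  -- Equality at `m` and order at `m + 1` leave the reference system with at most as many servers of
  -- length `≥ m`.
  have h1 := excess_eq_add q m
  have h2 := excess_eq_add q' m
  have h3 := h (m + 1) (by omega)
  have hocc : occupancy q' m ≤ occupancy q m := by omega
  simpa using hσ m hocc (σ.symm n) hle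

end TailSums

/-! ### Comparison of the arrivals -/

section Arrivals

variable {N : ℕ} (G : SimpleGraph (Fin N)) [DecidableRel G.Adj]

lemma card_primary {d : ℕ} (hG : G.IsRegularOfDegree d) (v : Fin N) :
    (primary G v).card = d + 1 := by
  rw [primary, Finset.card_insert_of_notMem (by simp), SimpleGraph.card_neighborFinset_eq_degree,
    hG.degree_eq]

lemma mem_primary_comm (v w : Fin N) : v ∈ primary G w ↔ w ∈ primary G v := by
  simp [primary, eq_comm, SimpleGraph.adj_comm]

lemma self_mem_primary (v : Fin N) : v ∈ primary G v := Finset.mem_insert_self _ _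

/-- Hockey-stick identity: the `k`-subsets of `{1, …, N}` with smallest element `i ≤ j`, and those
avoiding `{1, …, j}`. -/
lemma sum_choose_add_choose {N k : ℕ} (hk : 1 ≤ k) (j : ℕ) (hj : j ≤ N) :
    ∑ i ∈ Finset.Icc 1 j, (N - i).choose (k - 1) + (N - j).choose k = N.choose k := by
  obtain ⟨k, rfl⟩ := Nat.exists_eq_add_of_le' hk
  induction j with
  | zero => simp
  | succ j ih =>
    rw [Finset.sum_Icc_succ_top (by omega), ← ih (by omega)]
    have h : N - j = (N - (j + 1)) + 1 := by omega
    rw [h, Nat.choose_succ_succ, Nat.add_sub_cancel]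
    ring

/-- With `j = N - d - 1` in the hockey-stick identity, the hypothesis becomes `(N - d - 1) / N ≤
C(d+1,k) / C(N,k)` after clearing denominators. -/
lemma mul_choose_le_of_sum_lt {N d k : ℕ} (hk : 1 ≤ k) (hN : 0 < N) (hd : d + 1 ≤ N)
    (hdk : (∑ i ∈ Finset.Icc 1 (N - d - 1), ((N - i).choose (k - 1) : ℝ)) <
      ((d : ℝ) + 1) / (N : ℝ) * (N.choose k : ℝ)) :
    (N - (d + 1)) * N.choose k ≤ N * (d + 1).choose k := by
  have h := sum_choose_add_choose (N := N) hk (N - d - 1) (by omega)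
  rw [show N - (N - d - 1) = d + 1 by omega] at h
  have hN' : (0 : ℝ) < N := by exact_mod_cast hN
  have h' : (∑ i ∈ Finset.Icc 1 (N - d - 1), ((N - i).choose (k - 1) : ℝ)) +
      ((d + 1).choose k : ℝ) = (N.choose k : ℝ) := by exact_mod_cast h
  have h2 : (N : ℝ) * ((N.choose k : ℝ) - ((d + 1).choose k : ℝ)) <
      ((d : ℝ) + 1) * (N.choose k : ℝ) := by
    rw [← h', add_sub_cancel_right, h']
    calc (N : ℝ) * _ < N * (((d : ℝ) + 1) / (N : ℝ) * (N.choose k : ℝ)) :=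
          mul_lt_mul_of_pos_left hdk hN'
      _ = _ := by field_simp
  have h3 : ((N - (d + 1) : ℕ) : ℝ) * (N.choose k : ℝ) ≤ N * ((d + 1).choose k : ℝ) := by
    rw [Nat.cast_sub hd]
    push_cast
    linarith
  exact_mod_cast h3

variable {G}

/-- If the set `H` is not larger than `H'`, it contains the primary selection of a random arrival
with smaller probability than `H'` contains a random `k`-subset. -/
lemma card_primary_subset_mul_le {d k : ℕ} (hk : 1 ≤ k) (hN : 0 < N)
    (hG : G.IsRegularOfDegree d)
    (hdk : (∑ i ∈ Finset.Icc 1 (N - d - 1), ((N - i).choose (k - 1) : ℝ)) <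
      ((d : ℝ) + 1) / (N : ℝ) * (N.choose k : ℝ))
    {H H' : Finset (Fin N)} (hH : H.card ≤ H'.card) :
    (Finset.univ.filter fun v => primary G v ⊆ H).card * N.choose k ≤
      N * (H'.card).choose k := by
  have hcN : ∀ s : Finset (Fin N), s.card ≤ N := fun s => by simpa using s.card_le_univ
  by_cases hfull : H = Finset.univ
  · have h1 : H'.card = N := le_antisymm (hcN _) (by simpa [hfull] using hH)
    rw [h1]
    exact Nat.mul_le_mul_right _ (hcN _)
  obtain ⟨w, hw⟩ : ∃ w, w ∉ H := by
    by_contra! hall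
    exact hfull (Finset.eq_univ_iff_forall.mpr hall)
  by_cases hsmall : H.card < d + 1
  · have h0 : (Finset.univ.filter fun v => primary G v ⊆ H) = ∅ := by
      refine Finset.filter_eq_empty_iff.mpr fun v _ hv => ?_
      have := Finset.card_le_card hv
      rw [card_primary G hG] at this
      omega
    simp [h0]
  -- By symmetry of adjacency, the `d + 1` servers of `primary G w` all have the missing server `w`
  -- in their primary selection.
  have hsub : (Finset.univ.filter fun v => primary G v ⊆ H) ⊆ (primary G w)ᶜ := by
    intro v hv
    rw [Finset.mem_compl, mem_primary_comm]
    exact fun hwv => hw ((Finset.mem_filter.mp hv).2 hwv)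
  have hcard := Finset.card_le_card hsub
  rw [Finset.card_compl, Fintype.card_fin, card_primary G hG] at hcard
  have hd : d + 1 ≤ N := by
    rw [← card_primary G hG w]
    exact hcN _
  calc _ ≤ (N - (d + 1)) * N.choose k := Nat.mul_le_mul_right _ hcard
    _ ≤ N * (d + 1).choose k := mul_choose_le_of_sum_lt hk hN hd hdk
    _ ≤ _ := Nat.mul_le_mul_left _ (Nat.choose_le_choose k (by omega))

/-- The sets of servers that can be sampled in the reference system. -/
abbrev SampleSet (N k : ℕ) : Type :=
  {S : Finset (Fin N) // S ∈ (Finset.univ : Finset (Fin N)).powersetCard k}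

lemma card_sampleSet (N k : ℕ) : Fintype.card (SampleSet N k) = N.choose k := by
  simp [SampleSet]

lemma card_filter_sampleSet_subset (k : ℕ) (H : Finset (Fin N)) :
    (Finset.univ.filter fun S : SampleSet N k => S.1 ⊆ H).card = H.card.choose k := by
  rw [← Finset.card_powersetCard]
  refine Finset.card_bij (fun S _ => S.1) ?_ ?_ ?_
  · intro S hS
    exact Finset.mem_powersetCard.mpr
      ⟨(Finset.mem_filter.mp hS).2, (Finset.mem_powersetCard.mp S.2).2⟩
  · intro S _ S' _ h
    exact Subtype.ext h
  · intro S hS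
    have := Finset.mem_powersetCard.mp hS
    exact ⟨⟨S, Finset.mem_powersetCard.mpr ⟨Finset.subset_univ _, this.2⟩⟩, by simpa using this.1,
      rfl⟩

lemma typeI_addJob_of_mem (x : AffState N) {A : Finset (Fin N)} {u : Fin N} (hu : u ∈ A) :
    typeI (addJob x A u) = Function.update (typeI x) u (typeI x u + 1) := by
  funext n
  by_cases h : n = u
  · subst h; simp [typeI, addJob, hu]
  · simp [typeI, addJob, h]

lemma typeI_addJob_of_notMem (x : AffState N) {A : Finset (Fin N)} {u : Fin N} (hu : u ∉ A) :
    typeI (addJob x A u) = typeI x := by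
  funext n
  by_cases h : n = u
  · subst h; simp [typeI, addJob, hu]
  · simp [typeI, addJob, h]

/-- Arrivals in the two systems can be matched in such a way that the order is preserved. -/
lemma TailLE.exists_arrival_matching {d k : ℕ} (hk : 1 ≤ k) (hN : 0 < N)
    (hG : G.IsRegularOfDegree d)
    (hdk : (∑ i ∈ Finset.Icc 1 (N - d - 1), ((N - i).choose (k - 1) : ℝ)) <
      ((d : ℝ) + 1) / (N : ℝ) * (N.choose k : ℝ))
    {x : AffState N} {y : RefState N} (h : TailLE (typeI x) y) :
    ∃ σ : Equiv.Perm (Fin N × SampleSet N k), ∀ i u u', Admissible x (primary G i.1) u →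
      u' ∈ (σ i).2.1 →
      TailLE (typeI (addJob x (primary G i.1) u)) (Function.update y u' (y u' + 1)) := by
  by_cases hidle : ∃ w, Idle x w
  -- With an idle server any matching works: the job is of type II or raises only level 1, which
  -- each reference arrival raises as well.
  · refine ⟨1, fun i u u' hu _ => ?_⟩
    have key : Idle x u → TailLE (typeI (addJob x (primary G i.1) u))
        (Function.update y u' (y u' + 1)) := fun hiu => by
      by_cases hmem : u ∈ primary G i.1
      · rw [typeI_addJob_of_mem x hmem]
        refine h.update_succ fun m hm _ hle => ?_
        have : typeI x u = 0 := hiu.1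
        omega
      · rw [typeI_addJob_of_notMem x hmem]
        exact h.right_update_succ u'
    rcases hu with ⟨_, hiu⟩ | ⟨_, _, hiu⟩ | ⟨hno, _⟩
    · exact key hiu
    · exact key hiu
    · obtain ⟨w, hw⟩ := hidle
      exact absurd hw (hno w)
  · have hSne : ∀ S : SampleSet N k, S.1.Nonempty := fun S =>
      Finset.card_pos.mp (by rw [(Finset.mem_powersetCard.mp S.2).2]; exact hk)
    have hPne : ∀ v, (primary G v).Nonempty := fun v => ⟨v, self_mem_primary G v⟩
    let f : Fin N × SampleSet N k → ℕ := fun i => (primary G i.1).inf' (hPne i.1) (typeI x)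
    let g : Fin N × SampleSet N k → ℕ := fun i => i.2.1.inf' (hSne i.2) y
    -- The shortest queues in the primary selection and in the sample are matched by rank; one
    -- permutation serves all levels at once.
    obtain ⟨σ, hσ⟩ := exists_perm_rank_matching f g
    refine ⟨σ, fun i u u' hu hu' => ?_⟩
    rcases hu with ⟨_, hiu⟩ | ⟨_, _, hiu⟩ | ⟨_, hmem, hmin⟩
    · exact absurd ⟨u, hiu⟩ hidle
    · exact absurd ⟨u, hiu⟩ hidle
    rw [typeI_addJob_of_mem x hmem]
    refine h.update_succ fun m hm heq hle => ?_
    rcases Nat.lt_or_ge m 2 with hm2 | hm2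
    · omega
    obtain ⟨m, rfl⟩ : ∃ m', m = m' + 1 := ⟨m - 1, by omega⟩
    -- Here equality holds at `m + 1`, and the order at `m` gives the comparison of occupancies at
    -- `m`.
    have h1 := excess_eq_add (typeI x) m
    have h2 := excess_eq_add y m
    have h3 := h m (by omega)
    have hocc : occupancy (typeI x) m ≤ occupancy y m := by omega
    have hcount : (Finset.univ.filter fun i => m ≤ f i).card ≤
        (Finset.univ.filter fun i => m ≤ g i).card := by
      have hf : (Finset.univ.filter fun i => m ≤ f i) =
          (Finset.univ.filter fun v => primary G v ⊆ Finset.univ.filter fun n => m ≤ typeI x n) ×ˢ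
            (Finset.univ : Finset (SampleSet N k)) := by
        ext i
        simp [f, Finset.le_inf'_iff, Finset.subset_iff]
      have hg : (Finset.univ.filter fun i => m ≤ g i) = (Finset.univ : Finset (Fin N)) ×ˢ
          (Finset.univ.filter fun S : SampleSet N k =>
            S.1 ⊆ Finset.univ.filter fun n => m ≤ y n) := by
        ext i
        simp [g, Finset.le_inf'_iff, Finset.subset_iff]
      rw [hf, hg, Finset.card_product, Finset.card_product, card_filter_sampleSet_subset,
        Finset.card_univ, card_sampleSet, Finset.card_univ, Fintype.card_fin]
      exact card_primary_subset_mul_le hk hN hG hdk hocc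
    have hfi : m ≤ f i := by
      refine (Finset.le_inf'_iff _ _).mpr fun w hw => ?_
      have := hmin w hw
      change m ≤ (x w).1
      have hle' : m + 1 ≤ (x u).1 + 1 := hle
      omega
    have hgi := hσ m hcount i hfi
    exact Nat.succ_le_succ (hgi.trans (Finset.inf'_le y hu'))

end Arrivals

/-! ### The uniformized generators -/

/-- The operator `1 + r⁻¹ L`. -/
def uniformizedOp {S : Type*} (L : (S → ℝ) →ₗ[ℝ] (S → ℝ)) (r : ℝ) : (S → ℝ) →ₗ[ℝ] (S → ℝ) :=
  LinearMap.id + r⁻¹ • L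

lemma isUniformization_uniformizedOp {S : Type*} (L : (S → ℝ) →ₗ[ℝ] (S → ℝ)) {r : ℝ}
    (hr : r ≠ 0) (h1 : L (fun _ => 1) = 0)
    (hnn : ∀ f, (∀ x, 0 ≤ f x) → ∀ x, 0 ≤ uniformizedOp L r f x) :
    IsUniformization L r (uniformizedOp L r) where
  gen f x := by simp [uniformizedOp, hr]
  nonneg := hnn
  one := by simp [uniformizedOp, h1]

/-- `affGen` as a linear map. -/
def affGenLin {N : ℕ} (G : SimpleGraph (Fin N)) [DecidableRel G.Adj] (lam μ₁ μ₂ : ℝ)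
    (alloc : AffState N → Fin N → PMF (Fin N)) :
    (AffState N → ℝ) →ₗ[ℝ] (AffState N → ℝ) where
  toFun := affGen G lam μ₁ μ₂ alloc
  map_add' f g := by
    funext x
    simp only [affGen, Pi.add_apply, add_sub_add_comm, mul_add, Finset.sum_add_distrib]
    ring
  map_smul' c f := by
    funext x
    simp only [affGen, Pi.smul_apply, smul_eq_mul, RingHom.id_apply, ← mul_sub, mul_add,
      Finset.mul_sum]
    congr 1 <;> refine Finset.sum_congr rfl fun v _ => ?_
    · refine Finset.sum_congr rfl fun u _ => ?_
      ring
    · ring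

/-- `jsqGen` as a linear map. -/
def jsqGenLin {N : ℕ} (k : ℕ) (lam μ₁ : ℝ)
    (alloc : RefState N → Finset (Fin N) → PMF (Fin N)) :
    (RefState N → ℝ) →ₗ[ℝ] (RefState N → ℝ) where
  toFun := jsqGen k lam μ₁ alloc
  map_add' f g := by
    funext x
    simp only [jsqGen, Pi.add_apply, add_sub_add_comm, mul_add, Finset.sum_add_distrib]
    ring
  map_smul' c f := by
    funext x
    simp only [jsqGen, Pi.smul_apply, smul_eq_mul, RingHom.id_apply, ← mul_sub, mul_add,
      Finset.mul_sum]
    congr 1 <;> refine Finset.sum_congr rfl fun v _ => ?_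
    · refine Finset.sum_congr rfl fun u _ => ?_
      ring
    · ring

/-! ### The coupled transition -/

/-- The coupled step is the image of finitely many weights; for order preservation only indices of
positive weight matter. -/
lemma exists_pmf_of_weights {D Z : Type*} [Fintype D] [MeasurableSpace Z] [Countable Z]
    [MeasurableSingletonClass Z] (w : D → ℝ) (hw : ∀ i, 0 ≤ w i) (hsum : ∑ i, w i = 1)
    (ψ : D → Z) :
    ∃ c : PMF Z, (∀ g : Z → ℝ, (∀ z, 0 ≤ g z) →
        ∫⁻ z, ENNReal.ofReal (g z) ∂c.toMeasure = ENNReal.ofReal (∑ i, w i * g (ψ i))) ∧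
      ∀ z ∈ c.support, ∃ i, 0 < w i ∧ ψ i = z := by
  let w' : PMF D := PMF.ofFintype (fun i => ENNReal.ofReal (w i))
    (by rw [← ENNReal.ofReal_sum_of_nonneg fun i _ => hw i, hsum, ENNReal.ofReal_one])
  refine ⟨w'.map ψ, fun g hg => ?_, fun z hz => ?_⟩
  · let _ : MeasurableSpace D := ⊤
    rw [← PMF.toMeasure_map ψ w' (measurable_from_top), lintegral_map (measurable_of_countable _)
      measurable_from_top, lintegral_fintype,
      ENNReal.ofReal_sum_of_nonneg fun i _ => mul_nonneg (hw i) (hg _)]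
    refine Finset.sum_congr rfl fun i _ => ?_
    rw [PMF.toMeasure_apply_singleton _ _ (measurableSet_singleton i),
      ENNReal.ofReal_mul (hw i), mul_comm]
    rfl
  · rw [PMF.support_map] at hz
    obtain ⟨i, hi, rfl⟩ := hz
    refine ⟨i, ?_, rfl⟩
    have : ENNReal.ofReal (w i) ≠ 0 := hi
    simpa using this

lemma sum_toReal_pmf {α : Type*} [Fintype α] (p : PMF α) : ∑ a, (p a).toReal = 1 := by
  have h := p.tsum_coe
  rw [tsum_fintype] at h
  rw [← ENNReal.toReal_sum fun a _ => p.apply_ne_top a, h, ENNReal.toReal_one]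

section Coupling

variable {N : ℕ} {G : SimpleGraph (Fin N)} [DecidableRel G.Adj] {k : ℕ} {lam μ₁ μ₂ : ℝ}
  {alloc : AffState N → Fin N → PMF (Fin N)}
  {allocRef : RefState N → Finset (Fin N) → PMF (Fin N)}

lemma typeI_completeJob (x : AffState N) (u : Fin N) :
    typeI (completeJob x u) = Function.update (typeI x) u (typeI x u - 1) := by
  funext n
  by_cases h : n = u
  · subst h
    by_cases h0 : 0 < (x n).1
    · simp [typeI, completeJob, h0]
    · simp [typeI, completeJob, Nat.eq_zero_of_not_pos h0]
  · simp [typeI, completeJob, h]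

lemma completeJob_of_idle {x : AffState N} {u : Fin N} (h : Idle x u) : completeJob x u = x := by
  have : x u = (0, 0) := Prod.ext h.1 h.2
  simp [completeJob, this, Function.update_eq_self_iff]

/-- Indices of the randomness of one uniformized step: an arrival (the matched pair of an arrival
site and a sample set, and the servers selected by both allocation rules) or a potential
departure. -/
abbrev StepIndex (N k : ℕ) : Type :=
  ((Fin N × SampleSet N k) × Fin N × Fin N) ⊕ (Fin N × Bool)

variable (lam μ₁ μ₂ alloc allocRef) in
/-- The probabilities of one coupled uniformized step. -/
def stepWeight (x : AffState N) (y : RefState N) (σ : Equiv.Perm (Fin N × SampleSet N k)) :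
    StepIndex N k → ℝ
  | .inl (i, u, u') => (N * (lam + μ₁))⁻¹ * (lam / (N.choose k : ℝ)) *
      ((alloc x i.1 u).toReal * (allocRef y (σ i).2 u').toReal)
  | .inr (_, b) => (N * (lam + μ₁))⁻¹ * if b then μ₂ else μ₁ - μ₂

variable (G) in
/-- The state after one coupled uniformized step. -/
def stepState (x : AffState N) (y : RefState N) (τ : Equiv.Perm (Fin N)) :
    StepIndex N k → AffState N × RefState N
  | .inl (i, u, u') => (addJob x (primary G i.1) u, Function.update y u' (y u' + 1))
  | .inr (n, b) => (if 0 < (x n).1 ∨ b then completeJob x n else x,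
      Function.update y (τ n) (y (τ n) - 1))

/-- The sample set and the reference server sum out. The flag thins the potential departures: type-I
service ignores it and keeps rate `μ₁ = μ₂ + (μ₁ - μ₂)`, type-II service needs it and has rate `μ₂`.
-/
lemma sum_stepWeight_fst (hN : 0 < N) (hkN : k ≤ N) (hr : 0 < lam + μ₁) (x : AffState N)
    (y : RefState N) (σ : Equiv.Perm (Fin N × SampleSet N k)) (τ : Equiv.Perm (Fin N))
    (f : AffState N → ℝ) :
    ∑ i, stepWeight lam μ₁ μ₂ alloc allocRef x y σ i * f (stepState G x y τ i).1 =
      uniformizedOp (affGenLin G lam μ₁ μ₂ alloc) (N * (lam + μ₁)) f x := by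
  have hN' : (N : ℝ) ≠ 0 := by positivity
  have hC : (N.choose k : ℝ) ≠ 0 := by exact_mod_cast (Nat.choose_pos hkN).ne'
  have hr' := hr.ne'
  have harr : ∀ i : Fin N × SampleSet N k, ∑ p : Fin N × Fin N,
      stepWeight lam μ₁ μ₂ alloc allocRef x y σ (.inl (i, p)) *
        f (stepState G x y τ (.inl (i, p))).1 =
      (N * (lam + μ₁))⁻¹ * (lam / (N.choose k : ℝ)) *
        ∑ u, (alloc x i.1 u).toReal * f (addJob x (primary G i.1) u) := fun i => by
    rw [Fintype.sum_prod_type, Finset.mul_sum]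
    simp only [stepWeight, stepState]
    refine Finset.sum_congr rfl fun u _ => ?_
    rw [← Finset.sum_mul, ← Finset.mul_sum, ← Finset.mul_sum, sum_toReal_pmf]
    ring
  have hdep : ∀ n : Fin N, ∑ b : Bool, (N * (lam + μ₁))⁻¹ * (if b then μ₂ else μ₁ - μ₂) *
      f (if 0 < (x n).1 ∨ b then completeJob x n else x) =
      (N * (lam + μ₁))⁻¹ * (μ₁ * f x +
        serviceRate μ₁ μ₂ x n * (f (completeJob x n) - f x)) := fun n => by
    rw [Fintype.sum_bool]
    by_cases h1 : 0 < (x n).1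
    · simp only [h1, true_or, if_true, serviceRate, Bool.false_eq_true, if_false]
      ring
    · by_cases h2 : 0 < (x n).2
      · simp only [h1, false_or, if_true, serviceRate, Bool.false_eq_true, if_false, h2]
        ring
      · have : completeJob x n = x := completeJob_of_idle
          ⟨Nat.eq_zero_of_not_pos h1, Nat.eq_zero_of_not_pos h2⟩
        simp only [this, ite_self, serviceRate, h1, h2, if_false, if_true, Bool.false_eq_true]
        ring
  have hsub : ∀ v, ∑ u, (alloc x v u).toReal * (f (addJob x (primary G v) u) - f x) =
      ∑ u, (alloc x v u).toReal * f (addJob x (primary G v) u) - f x := fun v => by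
    simp_rw [mul_sub]
    rw [Finset.sum_sub_distrib, ← Finset.sum_mul, sum_toReal_pmf, one_mul]
  rw [Fintype.sum_sum_type, Fintype.sum_prod_type]
  simp_rw [harr]
  rw [Fintype.sum_prod_type (α₁ := Fin N) (α₂ := Bool)]
  simp only [stepWeight, stepState]
  simp_rw [hdep]
  rw [Fintype.sum_prod_type]
  simp only [Finset.sum_const, Finset.card_univ, card_sampleSet, nsmul_eq_mul]
  simp only [uniformizedOp, affGenLin, LinearMap.add_apply, LinearMap.smul_apply, Pi.add_apply,
    Pi.smul_apply, LinearMap.id_apply, LinearMap.coe_mk, AddHom.coe_mk, affGen, smul_eq_mul, hsub,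
    ← Finset.mul_sum, Finset.sum_add_distrib, Finset.sum_sub_distrib, Finset.sum_const,
    Finset.card_univ, Fintype.card_fin, nsmul_eq_mul]
  field_simp
  ring

/-- Arrival pairs and departing servers are uniform, so reindexing by `σ` and `τ` removes the
matchings from the second marginal. -/
lemma sum_stepWeight_snd (hN : 0 < N) (hkN : k ≤ N) (hr : 0 < lam + μ₁) (x : AffState N)
    (y : RefState N) (σ : Equiv.Perm (Fin N × SampleSet N k)) (τ : Equiv.Perm (Fin N))
    (g : RefState N → ℝ) :
    ∑ i, stepWeight lam μ₁ μ₂ alloc allocRef x y σ i * g (stepState G x y τ i).2 =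
      uniformizedOp (jsqGenLin k lam μ₁ allocRef) (N * (lam + μ₁)) g y := by
  have hN' : (N : ℝ) ≠ 0 := by positivity
  have hC : (N.choose k : ℝ) ≠ 0 := by exact_mod_cast (Nat.choose_pos hkN).ne'
  have hr' := hr.ne'
  have harr : ∀ i : Fin N × SampleSet N k, ∑ p : Fin N × Fin N,
      stepWeight lam μ₁ μ₂ alloc allocRef x y σ (.inl (i, p)) *
        g (stepState G x y τ (.inl (i, p))).2 =
      (N * (lam + μ₁))⁻¹ * (lam / (N.choose k : ℝ)) *
        ∑ u', (allocRef y (σ i).2 u').toReal * g (Function.update y u' (y u' + 1)) := fun i => by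
    rw [Fintype.sum_prod_type, Finset.sum_comm, Finset.mul_sum]
    simp only [stepWeight, stepState]
    refine Finset.sum_congr rfl fun u' _ => ?_
    rw [← Finset.sum_mul, ← Finset.mul_sum, ← Finset.sum_mul, sum_toReal_pmf]
    ring
  have hdep : ∀ n : Fin N, ∑ b : Bool, (N * (lam + μ₁))⁻¹ * (if b then μ₂ else μ₁ - μ₂) *
      g (Function.update y (τ n) (y (τ n) - 1)) =
      (N * (lam + μ₁))⁻¹ * (μ₁ * g y + (if 0 < y (τ n) then μ₁ else 0) *
        (g (Function.update y (τ n) (y (τ n) - 1)) - g y)) := fun n => by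
    rw [Fintype.sum_bool]
    by_cases h1 : 0 < y (τ n)
    · simp only [h1, if_true, Bool.false_eq_true, if_false]
      ring
    · have : Function.update y (τ n) (y (τ n) - 1) = y := by
        rw [Function.update_eq_self_iff]
        omega
      simp only [this, if_true, Bool.false_eq_true, if_false]
      ring
  have hsub : ∀ A, ∑ u, (allocRef y A u).toReal * (g (Function.update y u (y u + 1)) - g y) =
      ∑ u, (allocRef y A u).toReal * g (Function.update y u (y u + 1)) - g y := fun A => by
    simp_rw [mul_sub]
    rw [Finset.sum_sub_distrib, ← Finset.sum_mul, sum_toReal_pmf, one_mul]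
  rw [Fintype.sum_sum_type, Fintype.sum_prod_type]
  simp_rw [harr]
  rw [Fintype.sum_prod_type (α₁ := Fin N) (α₂ := Bool)]
  simp only [stepWeight, stepState]
  simp_rw [hdep]
  rw [Equiv.sum_comp σ fun i : Fin N × SampleSet N k => (N * (lam + μ₁))⁻¹ *
      (lam / (N.choose k : ℝ)) * ∑ u', (allocRef y i.2 u').toReal *
        g (Function.update y u' (y u' + 1)),
    Equiv.sum_comp τ fun n => (N * (lam + μ₁))⁻¹ * (μ₁ * g y + (if 0 < y n then μ₁ else 0) *
        (g (Function.update y n (y n - 1)) - g y)),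
    Fintype.sum_prod_type]
  have hcoe : ∑ S : SampleSet N k, ∑ u', (allocRef y S u').toReal *
      g (Function.update y u' (y u' + 1)) =
      ∑ S ∈ (Finset.univ : Finset (Fin N)).powersetCard k, ∑ u', (allocRef y S u').toReal *
        g (Function.update y u' (y u' + 1)) :=
    Finset.sum_coe_sort ((Finset.univ : Finset (Fin N)).powersetCard k) fun S =>
      ∑ u', (allocRef y S u').toReal * g (Function.update y u' (y u' + 1))
  simp only [Finset.sum_const, Finset.card_univ, Fintype.card_fin, nsmul_eq_mul, ← Finset.mul_sum,
    hcoe]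
  simp only [uniformizedOp, jsqGenLin, LinearMap.add_apply, LinearMap.smul_apply, Pi.add_apply,
    Pi.smul_apply, LinearMap.id_apply, LinearMap.coe_mk, AddHom.coe_mk, jsqGen, smul_eq_mul, hsub,
    ← Finset.mul_sum, Finset.sum_add_distrib, Finset.sum_sub_distrib, Finset.sum_const,
    Finset.card_univ, Fintype.card_fin, nsmul_eq_mul, Finset.card_powersetCard]
  field_simp
  ring

lemma stepWeight_nonneg (hlam : 0 < lam) (hμ₂ : 0 < μ₂) (hμ : μ₂ < μ₁) (x : AffState N)
    (y : RefState N) (σ : Equiv.Perm (Fin N × SampleSet N k)) (i : StepIndex N k) :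
    0 ≤ stepWeight lam μ₁ μ₂ alloc allocRef x y σ i := by
  have hμ₁ : 0 < μ₁ := hμ₂.trans hμ
  rcases i with ⟨i, u, u'⟩ | ⟨n, b⟩
  · simp only [stepWeight]
    positivity
  · simp only [stepWeight]
    have : 0 ≤ μ₁ - μ₂ := by linarith
    cases b <;> simp <;> positivity

/-- A coupling of the uniformized transitions of the two systems that preserves the order. -/
lemma exists_step_coupling {d : ℕ} (hk : 1 ≤ k) (hN : 0 < N) (hkN : k ≤ N)
    (hG : G.IsRegularOfDegree d)
    (hdk : (∑ i ∈ Finset.Icc 1 (N - d - 1), ((N - i).choose (k - 1) : ℝ)) <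
      ((d : ℝ) + 1) / (N : ℝ) * (N.choose k : ℝ))
    (hlam : 0 < lam) (hμ₂ : 0 < μ₂) (hμ : μ₂ < μ₁)
    (halloc : IsAffinityRule G alloc) (hallocRef : IsJSQRule k allocRef)
    (z : AffState N × RefState N) :
    ∃ c : PMF (AffState N × RefState N),
      (∀ f : AffState N → ℝ, (∀ x, 0 ≤ f x) → ∫⁻ z', ENNReal.ofReal (f z'.1) ∂c.toMeasure =
        ENNReal.ofReal (uniformizedOp (affGenLin G lam μ₁ μ₂ alloc) (N * (lam + μ₁)) f z.1) ∧
        0 ≤ uniformizedOp (affGenLin G lam μ₁ μ₂ alloc) (N * (lam + μ₁)) f z.1) ∧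
      (∀ g : RefState N → ℝ, (∀ y, 0 ≤ g y) → ∫⁻ z', ENNReal.ofReal (g z'.2) ∂c.toMeasure =
        ENNReal.ofReal (uniformizedOp (jsqGenLin k lam μ₁ allocRef) (N * (lam + μ₁)) g z.2) ∧
        0 ≤ uniformizedOp (jsqGenLin k lam μ₁ allocRef) (N * (lam + μ₁)) g z.2) ∧
      (TailLE (typeI z.1) z.2 → ∀ z' ∈ c.support, TailLE (typeI z'.1) z'.2) := by
  obtain ⟨x, y⟩ := z
  have hr : 0 < lam + μ₁ := add_pos hlam (hμ₂.trans hμ)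
  obtain ⟨σ, hσ⟩ : ∃ σ : Equiv.Perm (Fin N × SampleSet N k), TailLE (typeI x) y → ∀ i u u',
      Admissible x (primary G i.1) u → u' ∈ (σ i).2.1 →
      TailLE (typeI (addJob x (primary G i.1) u)) (Function.update y u' (y u' + 1)) := by
    by_cases h : TailLE (typeI x) y
    · exact (h.exists_arrival_matching hk hN hG hdk).imp fun σ hσ _ => hσ
    -- The step has to be defined for unordered states too; there any permutation gives the correct
    -- marginals.
    · exact ⟨1, fun h' => absurd h' h⟩
  obtain ⟨τ, hτ⟩ : ∃ τ : Equiv.Perm (Fin N), TailLE (typeI x) y → ∀ n,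
      TailLE (Function.update (typeI x) n (typeI x n - 1))
        (Function.update y (τ n) (y (τ n) - 1)) := by
    by_cases h : TailLE (typeI x) y
    · exact h.exists_departure_matching.imp fun τ hτ _ => hτ
    · exact ⟨1, fun h' => absurd h' h⟩
  have hw := stepWeight_nonneg (alloc := alloc) (allocRef := allocRef) hlam hμ₂ hμ x y σ
  have hsum : ∑ i, stepWeight lam μ₁ μ₂ alloc allocRef x y σ i = 1 := by
    have h := sum_stepWeight_fst (G := G) (μ₂ := μ₂) (alloc := alloc) (allocRef := allocRef)
      hN hkN hr x y σ τ fun _ => 1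
    simp only [mul_one] at h
    rw [h]
    simp [uniformizedOp, affGenLin, affGen]
  obtain ⟨c, hc, hsupp⟩ := exists_pmf_of_weights _ hw hsum (stepState G x y τ)
  refine ⟨c, fun f hf => ?_, fun g hg => ?_, fun h z' hz' => ?_⟩
  · rw [← sum_stepWeight_fst (G := G) (μ₂ := μ₂) (alloc := alloc) (allocRef := allocRef)
      hN hkN hr x y σ τ f]
    exact ⟨hc (fun z => f z.1) fun z => hf z.1,
      Finset.sum_nonneg fun i _ => mul_nonneg (hw i) (hf _)⟩
  · rw [← sum_stepWeight_snd (G := G) (μ₂ := μ₂) (alloc := alloc) (allocRef := allocRef)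
      hN hkN hr x y σ τ g]
    exact ⟨hc (fun z => g z.2) fun z => hg z.2,
      Finset.sum_nonneg fun i _ => mul_nonneg (hw i) (hg _)⟩
  · obtain ⟨i, hi, rfl⟩ := hsupp z' hz'
    rcases i with ⟨i, u, u'⟩ | ⟨n, b⟩
    · have hne : alloc x i.1 u ≠ 0 ∧ allocRef y (σ i).2 u' ≠ 0 := by
        constructor <;> intro h0 <;> simp [stepWeight, h0] at hi
      exact hσ h i u u' (halloc x i.1 u ((PMF.mem_support_iff _ _).mpr hne.1))
        (hallocRef y _ (Finset.mem_powersetCard.mp (σ i).2.2).2 u'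
          ((PMF.mem_support_iff _ _).mpr hne.2)).1
    · simp only [stepState]
      split_ifs with hx
      · rw [typeI_completeJob]
        exact hτ h n
      -- Without type-I jobs at `n`, an unchanged state has the same type-I vector as after a void
      -- departure.
      · have h0 : typeI x n = 0 := by
          rw [not_or] at hx
          exact Nat.eq_zero_of_not_pos hx.1
        have := hτ h n
        rwa [h0, Nat.zero_sub, ← h0, Function.update_eq_self] at this

end Coupling

/-! ### Uniqueness in law of Markov chains -/

section Uniqueness

variable {S Ω Ω' : Type*} [DecidableEq S] [MeasurableSpace S]
  [MeasurableSpace Ω] [MeasurableSpace Ω'] {L : (S → ℝ) → (S → ℝ)} {init : PMF S}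
  {P : Measure Ω} {Q : Measure Ω'} {X : ℝ≥0 → Ω → S} {Y : ℝ≥0 → Ω' → S}

lemma IsMarkovChain.measurable_path (hX : IsMarkovChain L init P X) :
    Measurable fun ω t => X t ω :=
  measurable_pi_iff.mpr hX.measurable

lemma IsMarkovChain.measureReal_forall_eq_of_zero (hX : IsMarkovChain L init P X)
    (hY : IsMarkovChain L init Q Y) (n : ℕ) (t : ℕ → ℝ≥0) (ht : Monotone t) (h0 : t 0 = 0)
    (x : ℕ → S) :
    P.real {ω | ∀ i ≤ n, X (t i) ω = x i} = Q.real {ω | ∀ i ≤ n, Y (t i) ω = x i} := by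
  induction n with
  | zero =>
    simp only [Nat.le_zero, forall_eq, h0, measureReal_def, hX.initial, hY.initial]
  | succ n ih => rw [hX.markov n t ht x, hY.markov n t ht x, ih]

variable [MeasurableSingletonClass S]

lemma IsMarkovChain.measurableSet_forall (hX : IsMarkovChain L init P X) (n : ℕ) (t : ℕ → ℝ≥0)
    (x : ℕ → S) : MeasurableSet {ω | ∀ i ≤ n, X (t i) ω = x i} := by
  simp only [Set.ofPred_forall]
  exact MeasurableSet.iInter fun i => MeasurableSet.iInter fun _ =>
    hX.measurable (t i) (measurableSet_singleton (x i))

variable [Countable S]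

/-- Time 0 is inserted and its state summed out, since the Markov recursion starts from the initial
distribution. -/
lemma IsMarkovChain.measure_forall_eq_tsum (hX : IsMarkovChain L init P X) (n : ℕ)
    (t : ℕ → ℝ≥0) (x : ℕ → S) :
    P {ω | ∀ i ≤ n, X (t i) ω = x i} =
      ∑' x₀, P {ω | ∀ i ≤ n + 1, X (consSeq 0 t i) ω = consSeq x₀ x i} := by
  rw [← measure_iUnion]
  · congr 1
    ext ω
    simp only [Set.mem_ofPred_eq, Set.mem_iUnion]
    constructor
    · refine fun h => ⟨X 0 ω, fun i hi => ?_⟩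
      cases i with
      | zero => rfl
      | succ i => exact h i (Nat.le_of_succ_le_succ hi)
    · rintro ⟨x₀, h⟩ i hi
      exact h (i + 1) (Nat.succ_le_succ hi)
  · intro a b hab
    refine Set.disjoint_left.mpr fun ω ha hb => hab ?_
    exact (ha 0 (Nat.zero_le _)).symm.trans (hb 0 (Nat.zero_le _))
  · exact fun x₀ => hX.measurableSet_forall (n + 1) _ _

lemma IsMarkovChain.measure_forall_eq [IsProbabilityMeasure P] [IsProbabilityMeasure Q]
    (hX : IsMarkovChain L init P X) (hY : IsMarkovChain L init Q Y) (n : ℕ) (t : ℕ → ℝ≥0)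
    (ht : Monotone t) (x : ℕ → S) :
    P {ω | ∀ i ≤ n, X (t i) ω = x i} = Q {ω | ∀ i ≤ n, Y (t i) ω = x i} := by
  rw [hX.measure_forall_eq_tsum, hY.measure_forall_eq_tsum]
  refine tsum_congr fun x₀ => ?_
  have hmono : Monotone (consSeq 0 t) := monotone_nat_of_le_succ fun i => by
    cases i with
    | zero => exact zero_le
    | succ i => exact ht (Nat.le_succ i)
  exact (measureReal_eq_measureReal_iff).mp
    (hX.measureReal_forall_eq_of_zero hY (n + 1) _ hmono rfl _)

/-- The law on path space of a Markov chain is determined by its generator and its initial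
distribution. -/
lemma IsMarkovChain.map_path_eq [IsProbabilityMeasure P] [IsProbabilityMeasure Q]
    (hX : IsMarkovChain L init P X) (hY : IsMarkovChain L init Q Y) :
    P.map (fun ω t => X t ω) = Q.map (fun ω t => Y t ω) := by
  have h1 := ProbabilityTheory.isProjectiveLimit_map (P := P) hX.measurable_path.aemeasurable
  have h2 := ProbabilityTheory.isProjectiveLimit_map (P := Q) hY.measurable_path.aemeasurable
  have hfin : ∀ I : Finset ℝ≥0, P.map (fun ω => I.restrict fun t => X t ω) =
      Q.map (fun ω => I.restrict fun t => Y t ω) := by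
    intro I
    have hmX : Measurable fun ω => I.restrict fun t => X t ω :=
      (Finset.measurable_restrict I).comp hX.measurable_path
    have hmY : Measurable fun ω => I.restrict fun t => Y t ω :=
      (Finset.measurable_restrict I).comp hY.measurable_path
    refine Measure.ext_of_singleton fun a => ?_
    rw [Measure.map_apply hmX (measurableSet_singleton a),
      Measure.map_apply hmY (measurableSet_singleton a)]
    rcases I.eq_empty_or_nonempty with rfl | hne
    · have huniv : ({a} : Set ((∅ : Finset ℝ≥0) → S)) = Set.univ :=
        Set.eq_univ_of_forall fun b => Subsingleton.elim b a
      rw [huniv, Set.preimage_univ, Set.preimage_univ, measure_univ, measure_univ]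
    · have hpos : 0 < I.card := hne.card_pos
      -- The times of `I` in increasing order, constant after the last one, form a monotone sequence
      -- on `ℕ` as in the Markov property.
      let e : ℕ → Fin I.card := fun i => ⟨min i (I.card - 1), by omega⟩
      have he : Monotone e := fun i j hij => by
        simp only [e, Fin.mk_le_mk]
        omega
      let t : ℕ → ℝ≥0 := fun i => I.orderEmbOfFin rfl (e i)
      have htI : ∀ i, t i ∈ I := fun i => I.orderEmbOfFin_mem rfl (e i)
      have key : ∀ z : ℝ≥0 → S, I.restrict z = a ↔
          ∀ i ≤ I.card - 1, z (t i) = a ⟨t i, htI i⟩ := by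
        intro z
        constructor
        · rintro rfl i _
          rfl
        · refine fun h => funext fun ⟨s, hs⟩ => ?_
          obtain ⟨j, rfl⟩ : ∃ j, I.orderEmbOfFin rfl j = s := by
            have : s ∈ Set.range (I.orderEmbOfFin rfl) := by
              rw [Finset.range_orderEmbOfFin]
              exact hs
            exact this
          have hej : e j = j := Fin.ext (min_eq_left (by omega))
          have := h j (by omega)
          simp only [t, hej] at this
          exact this
      have hsX : (fun ω => I.restrict fun t => X t ω) ⁻¹' {a} =
          {ω | ∀ i ≤ I.card - 1, X (t i) ω = a ⟨t i, htI i⟩} := by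
        ext ω
        exact key _
      have hsY : (fun ω => I.restrict fun t => Y t ω) ⁻¹' {a} =
          {ω | ∀ i ≤ I.card - 1, Y (t i) ω = a ⟨t i, htI i⟩} := by
        ext ω
        exact key _
      rw [hsX, hsY]
      exact hX.measure_forall_eq hY _ t
        (fun i j hij => (I.orderEmbOfFin rfl).monotone (he hij)) fun i => a ⟨t i, htI i⟩
  simp_rw [hfin] at h1
  exact h1.unique h2

end Uniqueness

/-! ### The coupled process -/

/-- Countably many steps and states: a single null set serves all initial states. -/
lemma ae_forall_skeleton {Z M : Type*} [MeasurableSpace M] [MeasurableSpace Z] [Countable Z]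
    {r : ℝ} (hr : 0 < r) {m : Measure M} [IsProbabilityMeasure m] {φ : Z → M → Z} {R : Z → Prop}
    (hR : ∀ z, R z → ∀ᵐ u ∂m, R (φ z u)) :
    ∀ᵐ ω ∂streamLaw r m, ∀ z, R z → ∀ n, R (skeleton φ n z ω) := by
  have := isProbabilityMeasure_expHolding hr
  have h : ∀ᵐ ω ∂streamLaw r m, ∀ (n : ℕ) (z : Z), R z → R (φ z (ω n).2) := by
    refine ae_all_iff.mpr fun n => ae_all_iff.mpr fun z => ?_
    by_cases hz : R z
    · have h1 := (Measure.quasiMeasurePreserving_snd (μ := expHolding r) (ν := m)).ae (hR z hz)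
      have h2 := (measurePreserving_eval_infinitePi (fun _ : ℕ => (expHolding r).prod m)
        n).quasiMeasurePreserving.ae h1
      filter_upwards [h2] with ω hω _ using hω
    · exact Eventually.of_forall fun ω h => absurd h hz
  filter_upwards [h] with ω hω z hz n
  induction n with
  | zero => exact hz
  | succ n ih => exact hω n _ ih

/-- Markov chains with generators `affGen` and `jsqGen` on a common probability space, ordered at
all times. -/
lemma exists_ordered_markov_chains {N d k : ℕ} (hk : 1 ≤ k) {G : SimpleGraph (Fin N)}
    [DecidableRel G.Adj] (hG : G.IsRegularOfDegree d)
    (hdk : (∑ i ∈ Finset.Icc 1 (N - d - 1), ((N - i).choose (k - 1) : ℝ)) <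
      ((d : ℝ) + 1) / (N : ℝ) * (N.choose k : ℝ))
    {lam μ₁ μ₂ : ℝ} (hlam : 0 < lam) (hμ₂ : 0 < μ₂) (hμ : μ₂ < μ₁)
    {alloc : AffState N → Fin N → PMF (Fin N)} (halloc : IsAffinityRule G alloc)
    {allocRef : RefState N → Finset (Fin N) → PMF (Fin N)} (hallocRef : IsJSQRule k allocRef)
    {initAff : PMF (AffState N)} {initRef : PMF (RefState N)}
    (hinit : InitiallyOrdered initAff initRef) :
    ∃ (Ω : Type) (_ : MeasurableSpace Ω) (P : Measure Ω)
        (X : ℝ≥0 → Ω → AffState N) (Y : ℝ≥0 → Ω → RefState N),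
      IsProbabilityMeasure P ∧
      IsMarkovChain (affGen G lam μ₁ μ₂ alloc) initAff P X ∧
      IsMarkovChain (jsqGen k lam μ₁ allocRef) initRef P Y ∧
      ∀ᵐ ω ∂P, ∀ (t : ℝ≥0) (m : ℕ+), tailSums (typeI (X t ω)) m ≤ tailSums (Y t ω) m := by
  -- Positivity of the right side excludes `N = 0` (division by zero gives 0) and `k > N` (the
  -- binomial coefficient vanishes).
  have hpos : 0 < ((d : ℝ) + 1) / (N : ℝ) * (N.choose k : ℝ) :=
    (Finset.sum_nonneg fun i _ => Nat.cast_nonneg _).trans_lt hdk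
  have hN : 0 < N := by
    rcases Nat.eq_zero_or_pos N with rfl | h
    · simp at hpos
    · exact h
  have hkN : k ≤ N := by
    by_contra h
    rw [Nat.choose_eq_zero_of_lt (not_le.mp h)] at hpos
    simp at hpos
  set r : ℝ := N * (lam + μ₁) with hrdef
  have hr : 0 < r := mul_pos (by exact_mod_cast hN) (add_pos hlam (hμ₂.trans hμ))
  choose c hcA hcB hcO using exists_step_coupling (alloc := alloc) (allocRef := allocRef)
    hk hN hkN hG hdk hlam hμ₂ hμ halloc hallocRef
  have hKA : IsUniformization (affGen G lam μ₁ μ₂ alloc) r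
      (uniformizedOp (affGenLin G lam μ₁ μ₂ alloc) r) :=
    isUniformization_uniformizedOp (affGenLin G lam μ₁ μ₂ alloc) hr.ne'
      (by funext x; simp [affGenLin, affGen]) fun f hf x => (hcA (x, fun _ => 0) f hf).2
  have hKB : IsUniformization (jsqGen k lam μ₁ allocRef) r
      (uniformizedOp (jsqGenLin k lam μ₁ allocRef) r) :=
    isUniformization_uniformizedOp (jsqGenLin k lam μ₁ allocRef) hr.ne'
      (by funext x; simp [jsqGenLin, jsqGen]) fun g hg y => (hcB (fun _ => (0, 0), y) g hg).2
  -- A mark is a random map with an independent coupled update for each state, and a jump evaluates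
  -- it at the current state. One mark law thus serves all states.
  let m : Measure (AffState N × RefState N → AffState N × RefState N) :=
    Measure.infinitePi fun z => (c z).toMeasure
  let φ : AffState N × RefState N → (AffState N × RefState N → AffState N × RefState N) →
    AffState N × RefState N := fun z u => u z
  have hφ : ∀ z, Measurable (φ z) := fun z => measurable_pi_apply z
  have heval : ∀ z, MeasurePreserving (φ z) m (c z).toMeasure := fun z =>
    measurePreserving_eval_infinitePi (fun z => (c z).toMeasure) z
  obtain ⟨c₀, hc₀A, hc₀B, hc₀⟩ := hinit
  refine ⟨(AffState N × RefState N) × (ℕ → ℝ≥0 ×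
    (AffState N × RefState N → AffState N × RefState N)), inferInstance,
    c₀.toMeasure.prod (streamLaw r m), fun t w => (jumpProcess φ w.1 t w.2).1,
    fun t w => (jumpProcess φ w.1 t w.2).2, ?_, ?_, ?_, ?_⟩
  · have := isProbabilityMeasure_streamLaw hr (m := m)
    infer_instance
  · rw [← hc₀A]
    refine isMarkovChain_jumpProcess hr hφ hKA Prod.fst (fun f hf z => ?_) c₀
    rw [← (hcA z f hf).1, ← (heval z).lintegral_comp (measurable_of_countable _)]
  · rw [← hc₀B]
    refine isMarkovChain_jumpProcess hr hφ hKB Prod.snd (fun g hg z => ?_) c₀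
    rw [← (hcB z g hg).1, ← (heval z).lintegral_comp (measurable_of_countable _)]
  · have := isProbabilityMeasure_streamLaw hr (m := m)
    have hsupp : ∀ p : PMF (AffState N × RefState N), ∀ᵐ z ∂p.toMeasure, z ∈ p.support :=
      fun p => by
        rw [ae_iff]
        exact (p.toMeasure_apply_eq_zero_iff (Set.to_countable _).measurableSet).mpr
          (Set.disjoint_left.mpr fun z hz hz' => hz' hz)
    have h1 := (Measure.quasiMeasurePreserving_fst (μ := c₀.toMeasure)
      (ν := streamLaw r m)).ae (hsupp c₀)
    have h2 := (Measure.quasiMeasurePreserving_snd (μ := c₀.toMeasure)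
      (ν := streamLaw r m)).ae (ae_forall_skeleton hr (φ := φ)
        (R := fun z => TailLE (typeI z.1) z.2) fun z hz => by
          filter_upwards [(heval z).quasiMeasurePreserving.ae (hsupp (c z))] with u hu
          exact hcO z hz _ hu)
    filter_upwards [h1, h2] with w hw1 hw2 t
    exact (forall_tailSums_le_iff _ _).mpr
      (hw2 w.1 ((forall_tailSums_le_iff _ _).mp (hc₀ w.1 hw1)) (jumpCount t w.2))

/-- An ordered coupling of two chains yields the stochastic order of all their versions. -/
lemma stochLE_of_coupling {S S' E Ω₀ Ω Ω' : Type*} [DecidableEq S] [DecidableEq S']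
    [MeasurableSpace S] [MeasurableSpace S'] [MeasurableSingletonClass S]
    [MeasurableSingletonClass S'] [Countable S] [Countable S'] [Preorder E] [MeasurableSpace E]
    [MeasurableSpace Ω₀] [MeasurableSpace Ω] [MeasurableSpace Ω']
    {L : (S → ℝ) → (S → ℝ)} {L' : (S' → ℝ) → (S' → ℝ)} {init : PMF S} {init' : PMF S'}
    (F : S → E) (F' : S' → E)
    {P₀ : Measure Ω₀} [IsProbabilityMeasure P₀] {X₀ : ℝ≥0 → Ω₀ → S} {Y₀ : ℝ≥0 → Ω₀ → S'}
    (hX₀ : IsMarkovChain L init P₀ X₀) (hY₀ : IsMarkovChain L' init' P₀ Y₀)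
    (hle : ∀ᵐ ω ∂P₀, ∀ t, F (X₀ t ω) ≤ F' (Y₀ t ω))
    {P : Measure Ω} {Q : Measure Ω'} [IsProbabilityMeasure P] [IsProbabilityMeasure Q]
    {X : ℝ≥0 → Ω → S} {Y : ℝ≥0 → Ω' → S'}
    (hX : IsMarkovChain L init P X) (hY : IsMarkovChain L' init' Q Y) :
    StochLE P (fun t ω => F (X t ω)) Q (fun t ω => F' (Y t ω)) := by
  intro U hU hup
  have hmF : Measurable fun (x : ℝ≥0 → S) t => F (x t) := measurable_pi_iff.mpr fun t =>
    (measurable_of_countable F).comp (measurable_pi_apply t)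
  have hmF' : Measurable fun (y : ℝ≥0 → S') t => F' (y t) := measurable_pi_iff.mpr fun t =>
    (measurable_of_countable F').comp (measurable_pi_apply t)
  -- Uniqueness in law moves both probabilities to the coupling space, where the order of paths
  -- gives an inclusion almost surely.
  have e1 : P {ω | (fun t => F (X t ω)) ∈ U} = P₀ {ω | (fun t => F (X₀ t ω)) ∈ U} := by
    have h := congrArg (fun ν => ν ((fun (x : ℝ≥0 → S) t => F (x t)) ⁻¹' U)) (hX.map_path_eq hX₀)
    rwa [Measure.map_apply hX.measurable_path (hmF hU),
      Measure.map_apply hX₀.measurable_path (hmF hU)] at h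
  have e2 : Q {ω | (fun t => F' (Y t ω)) ∈ U} = P₀ {ω | (fun t => F' (Y₀ t ω)) ∈ U} := by
    have h := congrArg (fun ν => ν ((fun (y : ℝ≥0 → S') t => F' (y t)) ⁻¹' U))
      (hY.map_path_eq hY₀)
    rwa [Measure.map_apply hY.measurable_path (hmF' hU),
      Measure.map_apply hY₀.measurable_path (hmF' hU)] at h
  rw [e1, e2]
  refine measure_mono_ae ?_
  filter_upwards [hle] with ω hω hmem
  exact hup (fun t => hω t) hmem

end AffinityScheduling

end

theorem theorem3 (N d k : ℕ) (hk : 1 ≤ k)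
    (G : SimpleGraph (Fin N)) [DecidableRel G.Adj] (hG : G.IsRegularOfDegree d)
    (hdk : (∑ i ∈ Finset.Icc 1 (N - d - 1), ((N - i).choose (k - 1) : ℝ)) <
      ((d : ℝ) + 1) / (N : ℝ) * (N.choose k : ℝ))
    (lam μ₁ μ₂ : ℝ) (hlam : 0 < lam) (hμ₂ : 0 < μ₂) (hμ : μ₂ < μ₁)
    (alloc : AffinityScheduling.AffState N → Fin N → PMF (Fin N))
    (halloc : AffinityScheduling.IsAffinityRule G alloc)
    (allocRef : AffinityScheduling.RefState N → Finset (Fin N) → PMF (Fin N))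
    (hallocRef : AffinityScheduling.IsJSQRule k allocRef)
    (initAff : PMF (AffinityScheduling.AffState N))
    (initRef : PMF (AffinityScheduling.RefState N))
    (hinit : AffinityScheduling.InitiallyOrdered initAff initRef) :
    (∃ (Ω : Type) (_ : MeasurableSpace Ω) (P : Measure Ω)
        (X : ℝ≥0 → Ω → AffinityScheduling.AffState N)
        (Y : ℝ≥0 → Ω → AffinityScheduling.RefState N),
      IsProbabilityMeasure P ∧
      AffinityScheduling.IsMarkovChain (AffinityScheduling.affGen G lam μ₁ μ₂ alloc) initAff P X ∧
      AffinityScheduling.IsMarkovChain (AffinityScheduling.jsqGen k lam μ₁ allocRef) initRef P Y ∧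
      ∀ᵐ ω ∂P, ∀ (t : ℝ≥0) (m : ℕ+),
        AffinityScheduling.tailSums (AffinityScheduling.typeI (X t ω)) m ≤
          AffinityScheduling.tailSums (Y t ω) m) ∧
    (∀ (Ω : Type*) (Ω' : Type*) [MeasurableSpace Ω] [MeasurableSpace Ω']
        (P : Measure Ω) (Q : Measure Ω') [IsProbabilityMeasure P] [IsProbabilityMeasure Q]
        (X : ℝ≥0 → Ω → AffinityScheduling.AffState N)
        (Y : ℝ≥0 → Ω' → AffinityScheduling.RefState N),
      AffinityScheduling.IsMarkovChain (AffinityScheduling.affGen G lam μ₁ μ₂ alloc) initAff P X →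
      AffinityScheduling.IsMarkovChain (AffinityScheduling.jsqGen k lam μ₁ allocRef) initRef Q Y →
      AffinityScheduling.StochLE
        P (fun t ω => AffinityScheduling.tailSums (AffinityScheduling.typeI (X t ω)))
        Q (fun t ω => AffinityScheduling.tailSums (Y t ω))) := by
  obtain ⟨Ω₀, mΩ₀, P₀, X₀, Y₀, hP₀, hX₀, hY₀, hle⟩ :=
    AffinityScheduling.exists_ordered_markov_chains hk hG hdk hlam hμ₂ hμ halloc hallocRef hinit
  refine ⟨⟨Ω₀, mΩ₀, P₀, X₀, Y₀, hP₀, hX₀, hY₀, hle⟩, ?_⟩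
  intro Ω Ω' _ _ P Q _ _ X Y hX hY
  exact AffinityScheduling.stochLE_of_coupling
    (fun x => AffinityScheduling.tailSums (AffinityScheduling.typeI x))
    AffinityScheduling.tailSums hX₀ hY₀ hle hX hY
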